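/- Let $(\Sigma,h)$ be a smooth (finite-dimensional, Hausdorff, boundaryless, not necessarily connected) Riemannian manifold, let $V\in C^\infty(\Sigma)$ with $V>0$, and let $(M,g)=(\mathbb{R}\times\Sigma,\;V^2dt^2-h)$ be the corresponding standard static spacetime, time-oriented by $\partial/\partial t$. Put $\Sigma_0=\{0\}\times\Sigma$ and $T(t,p)=(-t,p)$, and for $p\in\Sigma$, $r\ge 0$ let $C(p,r)=\{q\in\Sigma : d(p,q)\le r\}$, where $d$ is the distance on $\Sigma$ induced by the Riemannian metric $V^{-2}h$ (with $d(p,q)=\infty$ if $p,q$ lie in different components). For $S\subseteq M$, let $D^+(S)$ (respectively $D^-(S)$) be the set of $x\in M$ such that every past-inextendible (respectively future-inextendible) future-pointing smooth causal curve through $x$ intersects $S$, where a curve is past- (future-) inextendible if it has no limit in $M$ as its parameter tends to the lower (upper) end of its interval of definition, i.e. it has no continuous extension there; let $D(S)=D^+(S)\cup D^-(S)$. Then: \begin{enumerate} \item $D^+(\Sigma_0)=\{(t,p)\in M : t\ge 0,\ C(p,t)\text{ is compact in }\Sigma\}$. \item $D^-(\Sigma_0)=\{(-t,p)\in M : t\ge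 0,\ C(p,t)\text{ is compact in }\Sigma\}=T D^+(\Sigma_0)$. \item $D(\Sigma_0)=D^+(\Sigma_0)\cup D^-(\Sigma_0)=\{(t,p)\in M : C(p,|t|)\text{ is compact in }\Sigma\}$. \item $D(\Sigma_0)$ is open in $M$. \end{enumerate} -/

import Mathlib

open Set Filter Topology Bundle
open scoped Manifold ContDiff

noncomputable section

/-! ### Causal curves and Cauchy developments of a Lorentzian manifold

`g` is the metric, of signature `(+, -, …, -)`, and `X` is the timelike vector field that gives
the time-orientation. -/

section Causality

variable {F : Type*} [NormedAddCommGroup F] [NormedSpace ℝ F]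
  {H : Type*} [TopologicalSpace H] (I : ModelWithCorners ℝ F H)
  {M : Type*} [TopologicalSpace M] [ChartedSpace H M]

/-- A tangent vector `v` at `x` is causal: it is nonzero and `g(v, v) ≥ 0`. -/
def IsCausalVector (g : ∀ x : M, LinearMap.BilinForm ℝ (TangentSpace I x))
    {x : M} (v : TangentSpace I x) : Prop :=
  v ≠ 0 ∧ 0 ≤ g x v v

/-- The curve `γ`, defined on the non-degenerate interval `J` of `ℝ`, is a smooth future-pointing
causal curve. Values of `γ` outside `J` are irrelevant, and at an endpoint of `J` that
belongs to `J` the velocity is the one-sided one. -/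
structure IsFutureCausalCurve
    (g : ∀ x : M, LinearMap.BilinForm ℝ (TangentSpace I x))
    (X : ∀ x : M, TangentSpace I x) (γ : ℝ → M) (J : Set ℝ) : Prop where
  ordConnected : J.OrdConnected
  nontrivial : J.Nontrivial
  smooth : ContMDiffOn 𝓘(ℝ, ℝ) I ∞ γ J
  causal : ∀ s ∈ J, IsCausalVector I g (mfderivWithin 𝓘(ℝ, ℝ) I γ J s 1)
  future : ∀ s ∈ J, 0 < g (γ s) (mfderivWithin 𝓘(ℝ, ℝ) I γ J s 1) (X (γ s))

/-- `γ : J → M` cannot be continuously extended to the past: `γ s` has no limit in `M` as `s`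
decreases to `inf J ∈ [-∞, ∞)`. (If `J` has a least element, the limit is the value there.) -/
def IsPastInextendible (γ : ℝ → M) (J : Set ℝ) : Prop :=
  ¬ ∃ q : M, Tendsto (fun s : J => γ s) atBot (𝓝 q)

/-- `γ : J → M` cannot be continuously extended to the future: `γ s` has no limit in `M` as `s`
increases to `sup J ∈ (-∞, ∞]`. -/
def IsFutureInextendible (γ : ℝ → M) (J : Set ℝ) : Prop :=
  ¬ ∃ q : M, Tendsto (fun s : J => γ s) atTop (𝓝 q)

/-- The future Cauchy development `D⁺(A)`: the points `x` such that every past-inextendible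
future-pointing smooth causal curve through `x` meets `A`. -/
def futureCauchyDevelopment
    (g : ∀ x : M, LinearMap.BilinForm ℝ (TangentSpace I x))
    (X : ∀ x : M, TangentSpace I x) (A : Set M) : Set M :=
  {x | ∀ (γ : ℝ → M) (J : Set ℝ), IsFutureCausalCurve I g X γ J → IsPastInextendible γ J →
    x ∈ γ '' J → (γ '' J ∩ A).Nonempty}

/-- The past Cauchy development `D⁻(A)`: the points `x` such that every future-inextendible
future-pointing smooth causal curve through `x` meets `A`. -/
def pastCauchyDevelopment
    (g : ∀ x : M, LinearMap.BilinForm ℝ (TangentSpace I x))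
    (X : ∀ x : M, TangentSpace I x) (A : Set M) : Set M :=
  {x | ∀ (γ : ℝ → M) (J : Set ℝ), IsFutureCausalCurve I g X γ J → IsFutureInextendible γ J →
    x ∈ γ '' J → (γ '' J ∩ A).Nonempty}

/-- The Cauchy development `D(A) = D⁺(A) ∪ D⁻(A)`. -/
def cauchyDevelopment
    (g : ∀ x : M, LinearMap.BilinForm ℝ (TangentSpace I x))
    (X : ∀ x : M, TangentSpace I x) (A : Set M) : Set M :=
  futureCauchyDevelopment I g X A ∪ pastCauchyDevelopment I g X A

end Causality

/-! ### Standard static spacetimes `(ℝ × S, V² dt² - h)` -/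

section Static

variable {E : Type*} [NormedAddCommGroup E] [NormedSpace ℝ E]
  {S : Type*} [TopologicalSpace S] [ChartedSpace E S] [IsManifold 𝓘(ℝ, E) ∞ S]

/-- The metric `g = V² dt² - h` of `ℝ × S`, that is
`g(v, w) = V(p)² dt(v) dt(w) - h_p(dπ₂ v, dπ₂ w)` for `v`, `w` tangent at `x = (t, p)`, where
`dt = dπ₁` and `π₁`, `π₂` are the projections of `ℝ × S`. -/
def staticMetric
    (h : ContMDiffRiemannianMetric 𝓘(ℝ, E) ∞ E (fun p : S => TangentSpace 𝓘(ℝ, E) p))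
    (V : S → ℝ) (x : ℝ × S) :
    LinearMap.BilinForm ℝ (TangentSpace (𝓘(ℝ, ℝ).prod 𝓘(ℝ, E)) x) :=
  let dt : TangentSpace (𝓘(ℝ, ℝ).prod 𝓘(ℝ, E)) x →L[ℝ] ℝ :=
    mfderiv (𝓘(ℝ, ℝ).prod 𝓘(ℝ, E)) 𝓘(ℝ, ℝ) (Prod.fst : ℝ × S → ℝ) x
  let dp : TangentSpace (𝓘(ℝ, ℝ).prod 𝓘(ℝ, E)) x →L[ℝ] TangentSpace 𝓘(ℝ, E) x.2 :=
    mfderiv (𝓘(ℝ, ℝ).prod 𝓘(ℝ, E)) 𝓘(ℝ, E) (Prod.snd : ℝ × S → S) x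
  LinearMap.mk₂ ℝ (fun v w => V x.2 ^ 2 * (dt v * dt w) - h.inner x.2 (dp v) (dp w))
    (fun v v' w => by simp only [map_add, _root_.add_apply]; ring)
    (fun c v w => by
      simp only [map_smul, _root_.smul_apply, smul_eq_mul]; ring)
    (fun v w w' => by simp only [map_add]; ring)
    (fun c v w => by simp only [map_smul, smul_eq_mul]; ring)

/-- The vector field `∂/∂t` on `ℝ × S`: at `(t, p)`, the velocity of `s ↦ (s, p)` at `s = t`. -/
def timeVectorField (x : ℝ × S) : TangentSpace (𝓘(ℝ, ℝ).prod 𝓘(ℝ, E)) x :=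
  mfderiv 𝓘(ℝ, ℝ) (𝓘(ℝ, ℝ).prod 𝓘(ℝ, E)) (fun s : ℝ => (s, x.2)) x.1 1

/-- The Riemannian metric `V⁻² h` on `S`. -/
def conformalMetric
    (h : ContMDiffRiemannianMetric 𝓘(ℝ, E) ∞ E (fun p : S => TangentSpace 𝓘(ℝ, E) p))
    (V : S → ℝ) (hV : ContMDiff 𝓘(ℝ, E) 𝓘(ℝ, ℝ) ∞ V) (hpos : ∀ p, 0 < V p) :
    ContMDiffRiemannianMetric 𝓘(ℝ, E) ∞ E (fun p : S => TangentSpace 𝓘(ℝ, E) p) where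
  inner p := (V p ^ 2)⁻¹ • h.inner p
  symm p v w := by simp [h.symm p v w]
  pos p v hv := by
    have h1 := h.pos p v hv
    have h2 := hpos p
    simp only [_root_.smul_apply, smul_eq_mul]
    positivity
  isVonNBounded p := by
    have h2 := hpos p
    refine ((h.isVonNBounded p).image
      (V p • ContinuousLinearMap.id ℝ (TangentSpace 𝓘(ℝ, E) p))).subset ?_
    intro v hv
    refine ⟨(V p)⁻¹ • v, ?_, ?_⟩
    · simp only [mem_ofPred_eq, _root_.smul_apply, smul_eq_mul, map_smul] at hv ⊢
      convert hv using 1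
      field_simp
    · simp [smul_smul, h2.ne']
  contMDiff :=
    ((hV.pow 2).inv₀ fun p => (pow_pos (hpos p) 2).ne').smul_section h.contMDiff

/-- The (extended) distance on `S` of the Riemannian metric `k`: the infimum of the `k`-lengths
of the curves that join two points, which is `∞` when there is none. -/
def metricEDist
    (k : ContMDiffRiemannianMetric 𝓘(ℝ, E) ∞ E (fun p : S => TangentSpace 𝓘(ℝ, E) p))
    (p q : S) : ENNReal :=
  letI : RiemannianBundle (fun p : S => TangentSpace 𝓘(ℝ, E) p) := ⟨k.toRiemannianMetric⟩
  Manifold.riemannianEDist 𝓘(ℝ, E) p q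

/-- The closed ball `C(p, r)` for the distance of the Riemannian metric `k`. -/
def metricClosedBall
    (k : ContMDiffRiemannianMetric 𝓘(ℝ, E) ∞ E (fun p : S => TangentSpace 𝓘(ℝ, E) p))
    (p : S) (r : ℝ) : Set S :=
  {q | metricEDist k p q ≤ ENNReal.ofReal r}

/-- The static hypersurface `S₀ = {0} × S`. -/
def zeroSlice (S : Type*) : Set (ℝ × S) := {x | x.1 = 0}

/-- The time reflection `T(t, p) = (-t, p)`. -/
def timeReflection {S : Type*} (x : ℝ × S) : ℝ × S := (-x.1, x.2)

end Static

end

/-! A future causal curve satisfies `d(π₂ γ(s), π₂ γ(t)) ≤ |π₁ γ(s) - π₁ γ(t)|`, where `d` is the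
distance of `V⁻² h`. Hence a future causal curve through `(-t, p)` that misses the slice `{0} × S`
stays over `C(p, t)`, and if this ball is compact then the curve converges. If `C(p, t)` is not
compact, let `R ≤ t` be the least radius for which `C(p, R)` is not compact; it exists because a
slightly larger ball than a compact one is still compact. A limit of almost shortest paths from `p`
is a curve `c : [0, R) → S` with `d(c(s), c(s')) = |s - s'|` that does not converge at `R`. As `c`
realizes distances, it is a smooth geodesic, so that `s ↦ (s - t, c(s))` is a future-inextendible
causal curve through `(-t, p)`, and it does not reach the slice. -/

section LengthSpace

open Metric
open scoped ENNReal

/-- `X` is a length space. This is expressed without curves: points at prescribed distances `r`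
and `s` from `x` and `y` exist as soon as `r + s` exceeds the distance from `x` to `y`. -/
def HasApproxIntermediatePoints (X : Type*) [PseudoEMetricSpace X] : Prop :=
  ∀ (x y : X) (r s : ℝ≥0∞), 0 < s → edist x y < r + s → ∃ z, edist x z ≤ r ∧ edist z y ≤ s

namespace HasApproxIntermediatePoints

variable {X : Type*}

lemma exists_isCompact_closedEBall_add [PseudoEMetricSpace X] [LocallyCompactSpace X]
    (hX : HasApproxIntermediatePoints X) {p : X} {r : ℝ≥0∞} (hr : r ≠ ⊤)
    (h : IsCompact (closedEBall p r)) :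
    ∃ δ : ℝ, 0 < δ ∧ IsCompact (closedEBall p (r + ENNReal.ofReal δ)) := by
  obtain ⟨K, hK, hKr⟩ := exists_compact_superset h
  obtain ⟨δ, hδ, hsub⟩ := h.exists_cthickening_subset_open isOpen_interior hKr
  refine ⟨δ / 2, half_pos hδ, hK.of_isClosed_subset isClosed_closedEBall fun x hx => ?_⟩
  have hlt : edist p x < r + ENNReal.ofReal δ :=
    (mem_closedEBall'.1 hx).trans_lt <| ENNReal.add_lt_add_left hr <|
      (ENNReal.ofReal_lt_ofReal_iff hδ).2 (half_lt_self hδ)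
  obtain ⟨z, hz, hzx⟩ := hX p x r _ (ENNReal.ofReal_pos.2 hδ) hlt
  refine interior_subset (hsub (mem_cthickening_iff.2 ?_))
  exact (infEDist_le_edist_of_mem (mem_closedEBall'.2 hz)).trans (by rwa [edist_comm])

lemma exists_intermediate [PseudoEMetricSpace X] (hX : HasApproxIntermediatePoints X)
    {x y : X} {r s : ℝ≥0∞} (hr : r ≠ ⊤) (hs : s ≠ ⊤) (hc : IsCompact (closedEBall x r))
    (h : edist x y ≤ r + s) : ∃ z, edist x z ≤ r ∧ edist z y ≤ s := by
  obtain ⟨z, hz, hmin⟩ := hc.exists_isMinOn ⟨x, by simp⟩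
    (f := fun z => edist z y) (continuous_id.edist continuous_const).continuousOn
  refine ⟨z, mem_closedEBall'.1 hz, ENNReal.le_of_forall_pos_le_add fun ε hε _ => ?_⟩
  have hε' : (0 : ℝ≥0∞) < ε := by exact_mod_cast hε
  have hlt : edist x y < r + (s + ε) := by
    rw [← add_assoc]
    exact h.trans_lt (ENNReal.lt_add_right (by simp [hs, hr]) hε'.ne')
  obtain ⟨w, hw, hwy⟩ := hX x y r (s + ε) (by positivity) hlt
  exact (hmin (mem_closedEBall'.2 hw)).trans hwy

end HasApproxIntermediatePoints

lemma edist_eq_ofReal_sub {s t : ℝ} (h : s ≤ t) : edist s t = ENNReal.ofReal (t - s) := by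
  rw [edist_dist, dist_comm, Real.dist_eq, abs_of_nonneg (sub_nonneg.2 h)]

lemma edist_add_edist_of_le {s t u : ℝ} (hst : s ≤ t) (htu : t ≤ u) :
    edist s t + edist t u = edist s u := by
  rw [edist_eq_ofReal_sub hst, edist_eq_ofReal_sub htu, edist_eq_ofReal_sub (hst.trans htu),
    ← ENNReal.ofReal_add (sub_nonneg.2 hst) (sub_nonneg.2 htu), sub_add_sub_cancel']

section PseudoEMetric

variable {X : Type*} [PseudoEMetricSpace X]

lemma edist_le_of_lipschitzOnWith_one {Y : Type*} [PseudoEMetricSpace Y] {f : Y → X} {A : Set Y}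
    (hf : LipschitzOnWith 1 f A) {s t : Y} (hs : s ∈ A) (ht : t ∈ A) :
    edist (f s) (f t) ≤ edist s t := by
  simpa using hf hs ht

lemma edist_eq_of_lipschitzOnWith_one_of_le_edist {c : ℝ → X} {R : ℝ}
    (hc : LipschitzOnWith 1 c (Ico 0 R)) (hrad : ∀ s ∈ Ico 0 R, edist 0 s ≤ edist (c 0) (c s))
    {s t : ℝ} (hs : s ∈ Ico 0 R) (ht : t ∈ Ico 0 R) : edist (c s) (c t) = edist s t := by
  wlog hst : s ≤ t generalizing s t
  · rw [edist_comm, edist_comm s, this ht hs (le_of_not_ge hst)]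
  refine le_antisymm (edist_le_of_lipschitzOnWith_one hc hs ht) ?_
  have h0 : (0 : ℝ) ∈ Ico 0 R := ⟨le_rfl, hs.1.trans_lt hs.2⟩
  refine (ENNReal.add_le_add_iff_left (edist_ne_top 0 s)).1 ?_
  calc edist 0 s + edist s t = edist 0 t := edist_add_edist_of_le hs.1 hst
    _ ≤ edist (c 0) (c t) := hrad t ht
    _ ≤ edist (c 0) (c s) + edist (c s) (c t) := edist_triangle _ _ _
    _ ≤ edist 0 s + edist (c s) (c t) := by
      gcongr
      exact edist_le_of_lipschitzOnWith_one hc h0 hs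

lemma exists_lipschitzOnWith_forall_tendsto {ι Y : Type*} [PseudoEMetricSpace Y]
    {𝒲 : Ultrafilter ι} {f : ι → Y → X} {A : Set Y} {κ : NNReal}
    (hf : ∀ s ∈ A, ∀ t ∈ A, ∀ᶠ i in (𝒲 : Filter ι), edist (f i s) (f i t) ≤ κ * edist s t)
    (hK : ∀ s ∈ A, ∃ K, IsCompact K ∧ ∀ᶠ i in (𝒲 : Filter ι), f i s ∈ K) :
    ∃ c, LipschitzOnWith κ c A ∧ ∀ s ∈ A, Tendsto (f · s) 𝒲 (𝓝 (c s)) := by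
  have hlim : ∀ s, ∃ y, s ∈ A → Tendsto (f · s) 𝒲 (𝓝 y) := fun s => by
    by_cases hs : s ∈ A
    · obtain ⟨K, hK, hmem⟩ := hK s hs
      obtain ⟨y, -, hy⟩ := hK.ultrafilter_le_nhds (𝒲.map (f · s)) (le_principal_iff.2 hmem)
      exact ⟨y, fun _ => hy⟩
    · obtain ⟨i, -⟩ := (𝒲 : Filter ι).nonempty_of_mem univ_mem
      exact ⟨f i s, fun h => (hs h).elim⟩
  choose c hc using hlim
  exact ⟨c, fun s hs t ht => le_of_tendsto ((hc s hs).edist (hc t ht)) (hf s hs t ht), hc⟩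

lemma lipschitzOnWith_update_insert {f : ℝ → X} {A : Set ℝ} {q q' m : ℝ} {z : X}
    (hf : LipschitzOnWith 1 f A) (hm : m ∉ A) (hq : q ∈ A) (hq' : q' ∈ A)
    (hA : A ⊆ Iic q ∪ Ici q') (hqm : q ≤ m) (hmq' : m ≤ q')
    (hz : edist (f q) z ≤ edist q m) (hz' : edist z (f q') ≤ edist m q') :
    LipschitzOnWith 1 (Function.update f m z) (insert m A) := by
  have hz_le : ∀ s ∈ A, edist (f s) z ≤ edist s m := fun s hs => by
    rcases hA hs with hsq | hsq'
    · calc edist (f s) z ≤ edist (f s) (f q) + edist (f q) z := edist_triangle _ _ _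
        _ ≤ edist s q + edist q m := add_le_add (edist_le_of_lipschitzOnWith_one hf hs hq) hz
        _ = edist s m := edist_add_edist_of_le hsq hqm
    · rw [edist_comm, edist_comm s]
      calc edist z (f s) ≤ edist z (f q') + edist (f q') (f s) := edist_triangle _ _ _
        _ ≤ edist m q' + edist q' s := add_le_add hz' (edist_le_of_lipschitzOnWith_one hf hq' hs)
        _ = edist m s := edist_add_edist_of_le hmq' hsq'
  have hup : ∀ s ∈ A, Function.update f m z s = f s := fun s hs =>
    Function.update_of_ne (ne_of_mem_of_not_mem hs hm) _ _
  intro s hs t ht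
  rw [ENNReal.coe_one, one_mul]
  rcases hs with rfl | hs <;> rcases ht with rfl | ht
  · simp
  · rw [hup t ht, Function.update_self, edist_comm, edist_comm s]
    exact hz_le t ht
  · rw [hup s hs, Function.update_self]
    exact hz_le s hs
  · rw [hup s hs, hup t ht]
    exact edist_le_of_lipschitzOnWith_one hf hs ht

namespace HasApproxIntermediatePoints

lemma exists_lipschitzOnWith_finset (hX : HasApproxIntermediatePoints X)
    {p x : X} {R : ℝ} (hR : 0 < R) (hc : ∀ r < R, IsCompact (closedEBall p (ENNReal.ofReal r)))
    (hx : edist p x ≤ ENNReal.ofReal R) (F : Finset ℝ) (hF : ∀ s ∈ F, s ∈ Ioo 0 R) :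
    ∃ f : ℝ → X, f 0 = p ∧ f R = x ∧ LipschitzOnWith 1 f (insert 0 (insert R F)) := by
  induction F using Finset.induction_on_max with
  | empty =>
    refine ⟨fun s => if s ≤ 0 then p else x, if_pos le_rfl, if_neg hR.not_ge, ?_⟩
    have h0R : edist p x ≤ edist 0 R := by rwa [edist_eq_ofReal_sub hR.le, sub_zero]
    rintro s (rfl | rfl | hs) t (rfl | rfl | ht) <;> simp_all [edist_comm, hR.not_ge]
  | insert m F hmax ih =>
    obtain ⟨f, hf0, hfR, hf⟩ := ih fun s hs => hF s (Finset.mem_insert_of_mem hs)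
    obtain ⟨hm0, hmR⟩ := hF m (Finset.mem_insert_self _ _)
    have hlt : ∀ s ∈ insert 0 F, s < m := (Finset.forall_mem_insert _ _ _).2 ⟨hm0, hmax⟩
    obtain ⟨q, hqF, hq_max⟩ := (insert 0 F).exists_max_image id ⟨0, Finset.mem_insert_self _ _⟩
    have hq0 : 0 ≤ q := hq_max 0 (Finset.mem_insert_self _ _)
    have hqm : q ≤ m := (hlt q hqF).le
    set A : Set ℝ := insert 0 (insert R F)
    have hqA : q ∈ A := by simp only [Finset.mem_insert] at hqF; simp [A]; tauto
    have hRA : R ∈ A := mem_insert_of_mem _ (mem_insert _ _)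
    have hball : closedEBall (f q) (edist q m) ⊆ closedEBall p (ENNReal.ofReal m) := fun z hz => by
      rw [mem_closedEBall'] at hz ⊢
      calc edist p z ≤ edist (f 0) (f q) + edist (f q) z := hf0 ▸ edist_triangle _ _ _
        _ ≤ edist 0 q + edist q m :=
          add_le_add (edist_le_of_lipschitzOnWith_one hf (mem_insert _ _) hqA) hz
        _ = ENNReal.ofReal m := by
          rw [edist_add_edist_of_le hq0 hqm, edist_eq_ofReal_sub hm0.le, sub_zero]
    obtain ⟨z, hz, hz'⟩ := hX.exists_intermediate (edist_ne_top q m) (edist_ne_top m R)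
      ((hc m hmR).of_isClosed_subset isClosed_closedEBall hball) <| by
        rw [edist_add_edist_of_le hqm hmR.le]
        exact edist_le_of_lipschitzOnWith_one hf hqA hRA
    have hmA : m ∉ A := by
      rintro (h | h | h)
      exacts [hm0.ne' h, hmR.ne h, (hmax m h).false]
    refine ⟨Function.update f m z, ?_, ?_, ?_⟩
    · rw [Function.update_of_ne hm0.ne, hf0]
    · rw [Function.update_of_ne hmR.ne', hfR]
    · rw [Finset.coe_insert, insert_comm R, insert_comm 0]
      refine lipschitzOnWith_update_insert hf hmA hqA hRA ?_ hqm hmR.le hz hz'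
      rintro s (rfl | rfl | hs)
      exacts [.inl hq0, Or.inr self_mem_Ici, .inl (hq_max s (Finset.mem_insert_of_mem hs))]

end HasApproxIntermediatePoints

lemma le_nhds_of_tendsto_nhdsLT {X : Type*} [PseudoEMetricSpace X] {l : Filter X} {c : ℝ → X}
    {R : ℝ} {q : X} (hR : 0 < R) (hl : ∀ s ∈ Ico 0 R, ∀ ε, 0 < ε →
      ∀ᶠ x in l, edist (c s) x ≤ edist s R + ε) (hq : Tendsto c (𝓝[<] R) (𝓝 q)) : l ≤ 𝓝 q :=
  nhds_basis_closedEBall.ge_iff.2 fun ε hε => by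
    have hε3 : 0 < ε / 3 := ENNReal.div_pos hε.ne' (by simp)
    have hsR : ∀ᶠ s in 𝓝[<] R, edist s R ≤ ε / 3 :=
      tendsto_nhdsWithin_of_tendsto_nhds tendsto_id |>.eventually (closedEBall_mem_nhds R hε3)
    obtain ⟨s, hsq, hsR, hs⟩ := ((hq.eventually (closedEBall_mem_nhds q hε3)).and
      (hsR.and (Ico_mem_nhdsLT hR))).exists
    filter_upwards [hl s hs (ε / 3) hε3] with x hx
    calc edist x q ≤ edist x (c s) + edist (c s) q := edist_triangle _ _ _
      _ ≤ (ε / 3 + ε / 3) + ε / 3 := by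
        gcongr
        exact edist_comm x _ ▸ hx.trans (by gcongr)
      _ = ε := ENNReal.add_thirds ε

end PseudoEMetric

namespace HasApproxIntermediatePoints

variable {X : Type*} [EMetricSpace X]

lemma exists_lipschitzOnWith_Icc (hX : HasApproxIntermediatePoints X)
    {p x : X} {R : ℝ} (hR : 0 < R) (hc : ∀ r < R, IsCompact (closedEBall p (ENNReal.ofReal r)))
    (hx : edist p x ≤ ENNReal.ofReal R) :
    ∃ f : ℝ → X, f 0 = p ∧ f R = x ∧ LipschitzOnWith 1 f (Icc 0 R) := by
  have hfin : ∀ F : Finset ℝ, ∃ f : ℝ → X, f 0 = p ∧ f R = x ∧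
      LipschitzOnWith 1 f (insert 0 (insert R ↑(F.filter (· ∈ Ioo 0 R)))) := fun F =>
    hX.exists_lipschitzOnWith_finset hR hc hx _ fun s hs => (Finset.mem_filter.1 hs).2
  choose f hf0 hfR hf using hfin
  let 𝒲 : Ultrafilter (Finset ℝ) := .of atTop
  have h𝒲 : (𝒲 : Filter (Finset ℝ)) ≤ atTop := Ultrafilter.of_le _
  have hmem : ∀ s ∈ Icc 0 R, ∀ᶠ F in (𝒲 : Filter (Finset ℝ)),
      s ∈ insert 0 (insert R (F.filter (· ∈ Ioo 0 R) : Set ℝ)) := fun s hs => by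
    filter_upwards [h𝒲 (eventually_ge_atTop {s})] with F hF
    rcases eq_endpoints_or_mem_Ioo_of_mem_Icc hs with rfl | rfl | hs
    · exact mem_insert _ _
    · exact mem_insert_of_mem _ (mem_insert _ _)
    · exact mem_insert_of_mem _ (mem_insert_of_mem _ (by simpa [hs.1, hs.2] using hF))
  have hlip : ∀ s ∈ Icc 0 R, ∀ t ∈ Icc 0 R, ∀ᶠ F in (𝒲 : Filter (Finset ℝ)),
      edist (f F s) (f F t) ≤ (1 : NNReal) * edist s t := fun s hs t ht => by
    filter_upwards [hmem s hs, hmem t ht] with F hsF htF using hf F hsF htF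
  have hK : ∀ s ∈ Icc 0 R, ∃ K, IsCompact K ∧
      ∀ᶠ F in (𝒲 : Filter (Finset ℝ)), f F s ∈ K := fun s hs => by
    rcases hs.2.eq_or_lt with rfl | hsR
    · exact ⟨{x}, isCompact_singleton, .of_forall hfR⟩
    · refine ⟨_, hc s hsR, ?_⟩
      filter_upwards [hlip 0 ⟨le_rfl, hR.le⟩ s hs] with F hF
      rw [hf0] at hF
      rw [mem_closedEBall']
      simpa [edist_eq_ofReal_sub hs.1] using hF
  obtain ⟨c, hcl, hc⟩ := exists_lipschitzOnWith_forall_tendsto hlip hK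
  refine ⟨c, tendsto_nhds_unique (hc 0 ⟨le_rfl, hR.le⟩) ?_,
    tendsto_nhds_unique (hc R ⟨hR.le, le_rfl⟩) ?_, hcl⟩
  · exact tendsto_const_nhds.congr fun F => (hf0 F).symm
  · exact tendsto_const_nhds.congr fun F => (hfR F).symm

lemma exists_lipschitzOnWith_Ico (hX : HasApproxIntermediatePoints X)
    {p : X} {R : ℝ} (hR : 0 < R) (hc : ∀ r < R, IsCompact (closedEBall p (ENNReal.ofReal r)))
    {𝒰 : Ultrafilter X} (h𝒰 : ∀ᶠ x in (𝒰 : Filter X), edist p x ≤ ENNReal.ofReal R) :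
    ∃ c : ℝ → X, c 0 = p ∧ LipschitzOnWith 1 c (Ico 0 R) ∧ ∀ s ∈ Ico 0 R, ∀ ε, 0 < ε →
      ∀ᶠ x in (𝒰 : Filter X), edist (c s) x ≤ edist s R + ε := by
  have : Nonempty X := ⟨p⟩
  choose! f hf0 hfR hf using fun x => hX.exists_lipschitzOnWith_Icc (x := x) hR hc
  have h0R : (0 : ℝ) ∈ Ico 0 R := ⟨le_rfl, hR⟩
  have hlip : ∀ s ∈ Ico 0 R, ∀ t ∈ Ico 0 R, ∀ᶠ x in (𝒰 : Filter X),
      edist (f x s) (f x t) ≤ (1 : NNReal) * edist s t := fun s hs t ht => by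
    filter_upwards [h𝒰] with x hx
    exact hf x hx (Ico_subset_Icc_self hs) (Ico_subset_Icc_self ht)
  have hK : ∀ s ∈ Ico 0 R, ∃ K, IsCompact K ∧ ∀ᶠ x in (𝒰 : Filter X), f x s ∈ K := fun s hs => by
    refine ⟨_, hc s hs.2, ?_⟩
    filter_upwards [h𝒰, hlip 0 h0R s hs] with x hx hxs
    rw [hf0 x hx] at hxs
    rw [mem_closedEBall']
    simpa [edist_eq_ofReal_sub hs.1] using hxs
  obtain ⟨c, hcl, hclim⟩ := exists_lipschitzOnWith_forall_tendsto hlip hK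
  refine ⟨c, tendsto_nhds_unique (hclim 0 h0R) (tendsto_const_nhds.congr' ?_), hcl, ?_⟩
  · filter_upwards [h𝒰] with x hx using (hf0 x hx).symm
  · intro s hs ε hε
    filter_upwards [h𝒰, (hclim s hs).eventually (closedEBall_mem_nhds (c s) hε)] with x hx hxs
    calc edist (c s) x ≤ edist (c s) (f x s) + edist (f x s) x := edist_triangle _ _ _
      _ ≤ ε + edist s R := by
        refine add_le_add (mem_closedEBall'.1 hxs) ?_
        have := edist_le_of_lipschitzOnWith_one (hf x hx) (Ico_subset_Icc_self hs)
          (right_mem_Icc.2 hR.le)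
        rwa [hfR x hx] at this
      _ = edist s R + ε := add_comm _ _

theorem exists_ray (hX : HasApproxIntermediatePoints X) {p : X} {R : ℝ} (hR : 0 < R)
    (hc : ∀ r < R, IsCompact (closedEBall p (ENNReal.ofReal r)))
    (hnc : ¬ IsCompact (closedEBall p (ENNReal.ofReal R))) :
    ∃ c : ℝ → X, c 0 = p ∧ (∀ s ∈ Ico 0 R, ∀ t ∈ Ico 0 R, edist (c s) (c t) = edist s t) ∧
      ¬ ∃ q, Tendsto c (𝓝[<] R) (𝓝 q) := by
  rw [isCompact_iff_ultrafilter_le_nhds] at hnc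
  push Not at hnc
  obtain ⟨𝒰, h𝒰, h𝒰_lim⟩ := hnc
  -- the ray is the limit of segments from `p` to points that run out of every compact set
  obtain ⟨c, hc0, hclip, hclim⟩ := hX.exists_lipschitzOnWith_Ico hR hc
    (𝒰 := 𝒰) (by filter_upwards [le_principal_iff.1 h𝒰] with x hx using mem_closedEBall'.1 hx)
  have hfar : ∀ r < R, ∀ᶠ x in (𝒰 : Filter X), ENNReal.ofReal r ≤ edist p x := fun r hr => by
    by_contra hcon
    have hmem : ∀ᶠ x in (𝒰 : Filter X), x ∈ closedEBall p (ENNReal.ofReal r) := by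
      filter_upwards [𝒰.eventually_not.2 hcon] with x hx
      exact mem_closedEBall'.2 (not_le.1 hx).le
    obtain ⟨y, hy, hy'⟩ := (hc r hr).ultrafilter_le_nhds 𝒰 (le_principal_iff.2 hmem)
    exact h𝒰_lim y (closedEBall_subset_closedEBall (ENNReal.ofReal_le_ofReal hr.le) hy) hy'
  have hrad : ∀ s ∈ Ico 0 R, edist 0 s ≤ edist (c 0) (c s) := fun s hs => by
    refine ENNReal.le_of_forall_pos_le_add fun ε hε _ => ?_
    have hε' : (0 : ℝ) < ε / 2 := by positivity
    obtain ⟨x, hx, hx'⟩ := ((hfar (R - ε / 2) (by linarith)).and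
      (hclim s hs (ENNReal.ofReal (ε / 2)) (ENNReal.ofReal_pos.2 hε'))).exists
    have hεε : ENNReal.ofReal (ε / 2) + ENNReal.ofReal (ε / 2) = ε := by
      rw [← ENNReal.ofReal_add hε'.le hε'.le, add_halves, ENNReal.ofReal_coe_nnreal]
    refine (ENNReal.add_le_add_iff_right (edist_ne_top s R)).1 ?_
    calc edist 0 s + edist s R = ENNReal.ofReal (R - ε / 2 + ε / 2) := by
          rw [edist_add_edist_of_le hs.1 hs.2.le, edist_eq_ofReal_sub hR.le]; congr 1; ring
      _ ≤ edist p x + ENNReal.ofReal (ε / 2) := ENNReal.ofReal_add_le.trans (by gcongr)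
      _ ≤ edist (c 0) (c s) + (edist s R + ENNReal.ofReal (ε / 2)) + ENNReal.ofReal (ε / 2) := by
        rw [hc0]
        gcongr
        exact (edist_triangle _ (c s) _).trans (by gcongr)
      _ = edist (c 0) (c s) + ε + edist s R := by rw [← hεε]; ring
  refine ⟨c, hc0, fun s hs t ht => edist_eq_of_lipschitzOnWith_one_of_le_edist hclip hrad hs ht, ?_⟩
  rintro ⟨q, hq⟩
  have h𝒰q := le_nhds_of_tendsto_nhdsLT hR hclim hq
  exact h𝒰_lim q (isClosed_closedEBall.mem_of_tendsto h𝒰q (le_principal_iff.1 h𝒰)) h𝒰q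

lemma exists_first_noncompact_radius [LocallyCompactSpace X]
    (hX : HasApproxIntermediatePoints X) {p : X} {t : ℝ}
    (hnc : ¬ IsCompact (closedEBall p (ENNReal.ofReal t))) :
    ∃ R, 0 < R ∧ R ≤ t ∧ (∀ r < R, IsCompact (closedEBall p (ENNReal.ofReal r))) ∧
      ¬ IsCompact (closedEBall p (ENNReal.ofReal R)) := by
  set A : Set ℝ := {r | ¬ IsCompact (closedEBall p (ENNReal.ofReal r))}
  have h_nonpos : ∀ r ≤ 0, IsCompact (closedEBall p (ENNReal.ofReal r)) := fun r hr => by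
    rw [ENNReal.ofReal_of_nonpos hr, closedEBall_zero]
    exact isCompact_singleton
  have hA_nonneg : ∀ r ∈ A, 0 ≤ r := fun r hr =>
    le_of_not_ge fun h => hr (h_nonpos r h)
  have hA_bdd : BddBelow A := ⟨0, hA_nonneg⟩
  have hR : ¬ IsCompact (closedEBall p (ENNReal.ofReal (sInf A))) := by
    intro h
    obtain ⟨δ, hδ, hc⟩ := hX.exists_isCompact_closedEBall_add ENNReal.ofReal_ne_top h
    rw [← ENNReal.ofReal_add (Real.sInf_nonneg hA_nonneg) hδ.le] at hc
    obtain ⟨r, hr, hrδ⟩ := (csInf_lt_iff hA_bdd ⟨t, hnc⟩).1 (lt_add_of_pos_right (sInf A) hδ)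
    exact hr (hc.of_isClosed_subset isClosed_closedEBall
      (closedEBall_subset_closedEBall (ENNReal.ofReal_le_ofReal hrδ.le)))
  exact ⟨sInf A, not_le.1 fun h => hR (h_nonpos _ h), csInf_le hA_bdd hnc,
    fun r hr => not_not.1 (notMem_of_lt_csInf hr hA_bdd), hR⟩

lemma isOpen_setOf_isCompact_closedEBall [LocallyCompactSpace X]
    (hX : HasApproxIntermediatePoints X) :
    IsOpen {x : ℝ × X | IsCompact (closedEBall x.2 (ENNReal.ofReal |x.1|))} := by
  rw [isOpen_iff_mem_nhds]
  rintro ⟨t, p⟩ htp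
  obtain ⟨δ, hδ, hc⟩ := hX.exists_isCompact_closedEBall_add ENNReal.ofReal_ne_top htp
  have hδ2 : 0 < δ / 2 := half_pos hδ
  have h1 : ∀ᶠ x : ℝ × X in 𝓝 (t, p), |x.1| < |t| + δ / 2 :=
    (continuous_abs.comp continuous_fst).continuousAt.eventually_lt_const (by simpa using hδ2)
  have h2 : ∀ᶠ x : ℝ × X in 𝓝 (t, p), edist x.2 p ≤ ENNReal.ofReal (δ / 2) :=
    (continuous_snd.tendsto (t, p)).eventually
      (closedEBall_mem_nhds p (ENNReal.ofReal_pos.2 hδ2))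
  filter_upwards [h1, h2] with x hx1 hx2
  refine hc.of_isClosed_subset isClosed_closedEBall fun y hy => ?_
  calc edist y p ≤ edist y x.2 + edist x.2 p := edist_triangle _ _ _
    _ ≤ ENNReal.ofReal (|t| + δ / 2) + ENNReal.ofReal (δ / 2) :=
      add_le_add (hy.trans (ENNReal.ofReal_le_ofReal hx1.le)) hx2
    _ = ENNReal.ofReal |t| + ENNReal.ofReal δ := by
      rw [← ENNReal.ofReal_add (by positivity) hδ2.le, add_assoc, add_halves,
        ENNReal.ofReal_add (abs_nonneg _) hδ.le]

end HasApproxIntermediatePoints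

end LengthSpace

section Calculus

open MeasureTheory

variable {E : Type*} [NormedAddCommGroup E] [NormedSpace ℝ E]

lemma exists_continuous_eqOn_Icc {X : Type*} [TopologicalSpace X] {u : ℝ → X}
    {a b : ℝ} (hab : a ≤ b) (hu : ContinuousOn u (Icc a b)) :
    ∃ U : ℝ → X, Continuous U ∧ EqOn U u (Icc a b) ∧ ∀ s, U s ∈ u '' Icc a b :=
  ⟨fun s => u (projIcc a b hab s),
    hu.comp_continuous (by fun_prop) fun s => (projIcc a b hab s).2,
    fun s hs => by simp only [projIcc_of_mem hab hs],
    fun s => mem_image_of_mem u (projIcc a b hab s).2⟩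

lemma hasDerivAt_integral_of_continuous [CompleteSpace E] {f : ℝ → E} (hf : Continuous f)
    (a s : ℝ) : HasDerivAt (fun x => ∫ t in a..x, f t) (f s) s :=
  intervalIntegral.integral_hasDerivAt_right (hf.intervalIntegrable _ _)
    hf.stronglyMeasurable.stronglyMeasurableAtFilter hf.continuousAt

lemma hasDerivAt_integral_param_of_continuousOn {F F' : ℝ → ℝ → E} {a b δ : ℝ} (hab : a ≤ b)
    (hδ : 0 < δ) (hF : ContinuousOn (Function.uncurry F) (Icc (-δ) δ ×ˢ Icc a b))
    (hF' : ContinuousOn (Function.uncurry F') (Icc (-δ) δ ×ˢ Icc a b))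
    (hd : ∀ t ∈ Icc a b, ∀ ε ∈ Ioo (-δ) δ, HasDerivAt (fun x => F x t) (F' ε t) ε) :
    HasDerivAt (fun x => ∫ t in a..b, F x t) (∫ t in a..b, F' 0 t) 0 := by
  obtain ⟨C, hC⟩ := (isCompact_Icc.prod isCompact_Icc).exists_bound_of_continuousOn hF'
  have integrable_section {G : ℝ → ℝ → E}
      (hG : ContinuousOn (Function.uncurry G) (Icc (-δ) δ ×ˢ Icc a b)) {ε : ℝ}
      (hε : ε ∈ Icc (-δ) δ) : IntervalIntegrable (G ε) volume a b :=
    (hG.comp (f := fun t => (ε, t)) (by fun_prop) fun t ht =>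
      ⟨hε, ht⟩).intervalIntegrable_of_Icc hab
  have h0 : (0 : ℝ) ∈ Icc (-δ) δ := ⟨by linarith, hδ.le⟩
  have mem_Icc_of_mem {t : ℝ} (ht : t ∈ uIoc a b) : t ∈ Icc a b :=
    Ioc_subset_Icc_self (uIoc_of_le hab ▸ ht)
  refine (intervalIntegral.hasDerivAt_integral_of_dominated_loc_of_deriv_le
    (s := Ioo (-δ) δ) (bound := fun _ => C) (F' := F') (Ioo_mem_nhds (by linarith) hδ) ?_
    (integrable_section hF h0) (integrable_section hF' h0).def'.aestronglyMeasurable ?_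
    intervalIntegrable_const ?_).2
  · filter_upwards [Icc_mem_nhds (by linarith : -δ < 0) hδ] with ε hε using
      (integrable_section hF hε).def'.aestronglyMeasurable
  · exact Eventually.of_forall fun t ht ε hε =>
      hC (ε, t) ⟨Ioo_subset_Icc_self hε, mem_Icc_of_mem ht⟩
  · exact Eventually.of_forall fun t ht ε hε => hd t (mem_Icc_of_mem ht) ε hε

lemma hasDerivWithinAt_integral_of_continuousOn_Icc [CompleteSpace E] {v : ℝ → E} {a b s : ℝ}
    (hv : ContinuousOn v (Icc a b)) (hs : s ∈ Icc a b) :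
    HasDerivWithinAt (fun x => ∫ t in a..x, v t) (v s) (Icc a b) s := by
  obtain ⟨w, hw, hwv, -⟩ := exists_continuous_eqOn_Icc (hs.1.trans hs.2) hv
  have hcongr : ∀ x ∈ Icc a b, ∫ t in a..x, v t = ∫ t in a..x, w t := fun x hx =>
    intervalIntegral.integral_congr fun t ht =>
      (hwv (Icc_subset_Icc_right hx.2 (uIcc_of_le hx.1 ▸ ht))).symm
  rw [← hwv hs]
  exact (hasDerivAt_integral_of_continuous hw a s).hasDerivWithinAt.congr hcongr (hcongr s hs)

lemma contDiffOn_one_of_eq_const_add_integral [CompleteSpace E] {u v : ℝ → E} {a b : ℝ} {c : E}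
    (hab : a < b) (hv : ContinuousOn v (Icc a b))
    (h : ∀ s ∈ Icc a b, u s = c + ∫ t in a..s, v t) : ContDiffOn ℝ 1 u (Icc a b) := by
  have hderiv : ∀ s ∈ Icc a b, HasDerivWithinAt u (v s) (Icc a b) s := fun s hs =>
    ((hasDerivWithinAt_integral_of_continuousOn_Icc hv hs).const_add c).congr h (h s hs)
  rw [contDiffOn_one_iff_derivWithin (uniqueDiffOn_Icc hab)]
  exact ⟨fun s hs => (hderiv s hs).differentiableWithinAt,
    hv.congr fun s hs => (hderiv s hs).derivWithin (uniqueDiffOn_Icc hab s hs)⟩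

section DuBoisReymond

variable {a b : ℝ}

lemma exists_eq_const_of_forall_integral_mul_deriv_eq_zero {g : ℝ → ℝ} (hab : a < b)
    (hg : ContinuousOn g (Icc a b))
    (h : ∀ f f' : ℝ → ℝ, (∀ t, HasDerivAt f (f' t) t) → Continuous f' → f a = 0 → f b = 0 →
      ∫ t in a..b, g t * f' t = 0) :
    ∃ c, ∀ t ∈ Icc a b, g t = c := by
  obtain ⟨G, hG, hGg, -⟩ := exists_continuous_eqOn_Icc hab.le hg
  set c : ℝ := (b - a)⁻¹ * ∫ t in a..b, G t
  have hGc : Continuous fun t => G t - c := by fun_prop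
  have hmean : ∫ t in a..b, (G t - c) = 0 := by
    rw [intervalIntegral.integral_sub (hG.intervalIntegrable _ _) intervalIntegrable_const,
      intervalIntegral.integral_const, smul_eq_mul, mul_inv_cancel_left₀ (sub_ne_zero.2 hab.ne'),
      sub_self]
  have horth : ∫ t in a..b, G t * (G t - c) = 0 := by
    rw [← h _ _ (hasDerivAt_integral_of_continuous hGc a) hGc intervalIntegral.integral_same hmean]
    refine intervalIntegral.integral_congr fun t ht => ?_
    simp only [hGg (uIcc_of_le hab.le ▸ ht)]
  have hsq : ∫ t in a..b, (G t - c) ^ 2 = 0 := by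
    have expand : ∀ t, (G t - c) ^ 2 = G t * (G t - c) - c * (G t - c) := fun t => by ring
    simp only [expand]
    rw [intervalIntegral.integral_sub (Continuous.intervalIntegrable (by fun_prop) _ _)
      (Continuous.intervalIntegrable (by fun_prop) _ _), horth,
      intervalIntegral.integral_const_mul, hmean, mul_zero, sub_zero]
  refine ⟨c, fun t ht => hGg ht ▸ sub_eq_zero.1 ?_⟩
  by_contra hne
  exact (intervalIntegral.integral_pos hab (by fun_prop) (fun _ _ => sq_nonneg _)
    ⟨t, ht, by positivity⟩).ne' hsq

/-- The lemma of du Bois-Reymond. -/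
lemma exists_eq_const_add_integral_of_forall_integral_eq_zero {P Q : ℝ → ℝ} (hab : a < b)
    (hP : ContinuousOn P (Icc a b)) (hQ : ContinuousOn Q (Icc a b))
    (h : ∀ f f' : ℝ → ℝ, (∀ t, HasDerivAt f (f' t) t) → Continuous f' → f a = 0 → f b = 0 →
      ∫ t in a..b, (Q t * f t + P t * f' t) = 0) :
    ∃ c, ∀ t ∈ Icc a b, P t = c + ∫ x in a..t, Q x := by
  have hprim : ∀ t ∈ Icc a b, HasDerivWithinAt (fun t => ∫ x in a..t, Q x) (Q t) (Icc a b) t :=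
    fun t ht => hasDerivWithinAt_integral_of_continuousOn_Icc hQ ht
  have hprim_cont : ContinuousOn (fun t => ∫ x in a..t, Q x) (Icc a b) :=
    fun t ht => (hprim t ht).continuousWithinAt
  obtain ⟨c, hc⟩ := exists_eq_const_of_forall_integral_mul_deriv_eq_zero
    (g := fun t => P t - ∫ x in a..t, Q x) hab (hP.sub hprim_cont) fun f f' hf hf' ha hb => by
      have hfc : Continuous f := continuous_iff_continuousAt.2 fun t => (hf t).continuousAt
      have by_parts : ∫ t in a..b, (Q t * f t + (∫ x in a..t, Q x) * f' t) = 0 := by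
        rw [intervalIntegral.integral_deriv_mul_eq_sub_of_hasDerivWithinAt
          (by rwa [uIcc_of_le hab.le]) (fun t _ => (hf t).hasDerivWithinAt)
          (hQ.intervalIntegrable_of_Icc hab.le) (hf'.intervalIntegrable _ _), ha, hb]
        simp only [mul_zero, sub_zero]
      have expand : ∀ t, (P t - ∫ x in a..t, Q x) * f' t =
          (Q t * f t + P t * f' t) - (Q t * f t + (∫ x in a..t, Q x) * f' t) := fun t => by ring
      have hQf : ContinuousOn (fun t => Q t * f t) (Icc a b) := hQ.mul hfc.continuousOn
      have integrable_add_mul {R : ℝ → ℝ} (hR : ContinuousOn R (Icc a b)) :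
          IntervalIntegrable (fun t => Q t * f t + R t * f' t) volume a b :=
        (hQf.add (hR.mul hf'.continuousOn)).intervalIntegrable_of_Icc hab.le
      simp only [expand]
      rw [intervalIntegral.integral_sub (integrable_add_mul hP) (integrable_add_mul hprim_cont),
        h f f' hf hf' ha hb, by_parts, sub_zero]
  exact ⟨c, fun t ht => by rw [← hc t ht]; ring⟩

end DuBoisReymond

section SecondDifference

lemma exists_tendstoUniformlyOn_of_dist_le_geometric {α X : Type*} [PseudoMetricSpace X]
    [CompleteSpace X] [Nonempty X] {q : ℕ → α → X} {A : Set α} {K r : ℝ} (hr0 : 0 ≤ r) (hr1 : r < 1)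
    (h : ∀ x ∈ A, ∀ n, dist (q n x) (q (n + 1) x) ≤ K * r ^ n) :
    ∃ v, TendstoUniformlyOn q v atTop A := by
  have hlim : ∀ x ∈ A, ∃ y, Tendsto (fun n => q n x) atTop (𝓝 y) := fun x hx =>
    cauchySeq_tendsto_of_complete (cauchySeq_of_le_geometric r K hr1 (h x hx))
  choose! v hv using hlim
  have hgeom : Tendsto (fun n : ℕ => K * r ^ n / (1 - r)) atTop (𝓝 0) := by
    simpa using ((tendsto_pow_atTop_nhds_zero_of_lt_one hr0 hr1).const_mul K).div_const (1 - r)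
  refine ⟨v, Metric.tendstoUniformlyOn_iff.2 fun ε hε => ?_⟩
  filter_upwards [hgeom.eventually_lt_const hε] with n hn x hx
  rw [dist_comm]
  exact (dist_le_of_le_geometric_of_tendsto r K hr1 (h x hx) (hv x hx) n).trans_lt hn

variable {u : ℝ → E} {C k s : ℝ}

lemma dist_slope_double_slope_le (hk : 0 < k)
    (h : ‖u (s + 2 * k) - (2 : ℝ) • u (s + k) + u s‖ ≤ C * (k * √k)) :
    dist ((2 * k)⁻¹ • (u (s + 2 * k) - u s)) (k⁻¹ • (u (s + k) - u s)) ≤ C / 2 * √k := by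
  have hhalf : k⁻¹ = (2 * k)⁻¹ * 2 := by field_simp
  have hdiff : (2 * k)⁻¹ • (u (s + 2 * k) - u s) - k⁻¹ • (u (s + k) - u s) =
      (2 * k)⁻¹ • (u (s + 2 * k) - (2 : ℝ) • u (s + k) + u s) := by
    rw [hhalf, mul_smul]
    module
  rw [dist_eq_norm, hdiff, norm_smul, Real.norm_of_nonneg (by positivity)]
  calc (2 * k)⁻¹ * ‖u (s + 2 * k) - (2 : ℝ) • u (s + k) + u s‖
      ≤ (2 * k)⁻¹ * (C * (k * √k)) := by gcongr
    _ = C / 2 * √k := by field_simp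

lemma integral_slope_eq_sub (hu : Continuous u) (k a s : ℝ) :
    ∫ t in a..s, k⁻¹ • (u (t + k) - u t) =
      k⁻¹ • (∫ t in s..(s + k), u t) - k⁻¹ • ∫ t in a..(a + k), u t := by
  have hint : ∀ x y, IntervalIntegrable u volume x y := hu.intervalIntegrable
  rw [intervalIntegral.integral_smul, intervalIntegral.integral_sub
    (Continuous.intervalIntegrable (by fun_prop) _ _) (hint _ _),
    intervalIntegral.integral_comp_add_right, ← smul_sub,
    intervalIntegral.integral_interval_sub_interval_comm' (hint _ _) (hint _ _) (hint _ _)]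

variable [CompleteSpace E]

lemma tendsto_inv_smul_integral_add (hu : Continuous u) (s : ℝ) :
    Tendsto (fun k => k⁻¹ • ∫ t in s..(s + k), u t) (𝓝[≠] 0) (𝓝 (u s)) := by
  simpa using hasDerivAt_iff_tendsto_slope_zero.1 (hasDerivAt_integral_of_continuous hu s s)

lemma sub_eq_integral_of_tendstoUniformlyOn_slope {v : ℝ → E} {a b : ℝ} {k : ℕ → ℝ}
    (hu : Continuous u) (hk : Tendsto k atTop (𝓝[≠] 0))
    (h : TendstoUniformlyOn (fun n t => (k n)⁻¹ • (u (t + k n) - u t)) v atTop (Icc a b))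
    (hs : s ∈ Icc a b) : u s - u a = ∫ t in a..s, v t := by
  have hmean : ∀ x, Tendsto (fun n => (k n)⁻¹ • ∫ t in x..(x + k n), u t) atTop (𝓝 (u x)) :=
    fun x => (tendsto_inv_smul_integral_add hu x).comp hk
  have hsub : uIcc a s ⊆ Icc a b := uIcc_of_le hs.1 ▸ Icc_subset_Icc_right hs.2
  have hlim := (h.mono hsub).tendsto_intervalIntegral_of_continuousOn (μ := volume) <|
    Eventually.of_forall fun n => Continuous.continuousOn (by fun_prop)
  refine tendsto_nhds_unique ((hmean s).sub (hmean a)) (hlim.congr fun n => ?_)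
  exact integral_slope_eq_sub hu (k n) a s

lemma sqrt_mul_half_pow {η : ℝ} (hη : 0 ≤ η) (n : ℕ) :
    √(η * (1 / 2) ^ n) = √η * √(1 / 2) ^ n := by
  have hsq : ((1 : ℝ) / 2) ^ n = (√(1 / 2) ^ n) ^ 2 := by
    rw [← pow_mul, mul_comm n, pow_mul, Real.sq_sqrt (by norm_num)]
  rw [Real.sqrt_mul hη, hsq, Real.sqrt_sq (by positivity)]

lemma tendsto_mul_half_pow {η : ℝ} (hη : 0 < η) :
    Tendsto (fun n : ℕ => η * (1 / 2) ^ n) atTop (𝓝[≠] 0) := by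
  refine tendsto_nhdsWithin_iff.2
    ⟨?_, Eventually.of_forall fun n => ne_of_gt (by positivity : 0 < η * (1 / 2) ^ n)⟩
  simpa using (tendsto_pow_atTop_nhds_zero_of_lt_one (by norm_num : (0 : ℝ) ≤ 1 / 2)
    (by norm_num)).const_mul η

/-- The difference quotients with steps `η / 2 ^ n` form a uniformly convergent sequence, because
successive ones differ by `O(√(η / 2 ^ n))`. -/
theorem contDiffOn_one_of_second_difference_le {a b b' : ℝ}
    (hab : a < b') (hb : b' < b) (hu : ContinuousOn u (Icc a b))
    (h : ∀ s k, 0 < k → a ≤ s → s + 2 * k ≤ b →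
      ‖u (s + 2 * k) - (2 : ℝ) • u (s + k) + u s‖ ≤ C * (k * √k)) :
    ContDiffOn ℝ 1 u (Icc a b') := by
  obtain ⟨U, hU, hUu, -⟩ := exists_continuous_eqOn_Icc (hab.trans hb).le hu
  have hη : 0 < b - b' := sub_pos.2 hb
  set k : ℕ → ℝ := fun n => (b - b') * (1 / 2) ^ n with k_def
  have hk_pos : ∀ n, 0 < k n := fun n => by positivity
  have hk_le : ∀ n, k n ≤ b - b' := fun n =>
    mul_le_of_le_one_right hη.le (pow_le_one₀ (by norm_num) (by norm_num))
  have hk_succ : ∀ n, k n = 2 * k (n + 1) := fun n => by simp only [k_def, pow_succ]; ring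
  have hstep : ∀ s ∈ Icc a b', ∀ n, dist ((k n)⁻¹ • (U (s + k n) - U s))
      ((k (n + 1))⁻¹ • (U (s + k (n + 1)) - U s)) ≤
        C / 2 * (√(b - b') * √(1 / 2)) * √(1 / 2) ^ n := by
    intro s hs n
    have hsb : s + 2 * k (n + 1) ≤ b := by linarith [hk_succ n, hk_le n, hs.2]
    have hpos := hk_pos (n + 1)
    rw [hk_succ n]
    refine (dist_slope_double_slope_le (C := C) hpos ?_).trans_eq
      (by rw [sqrt_mul_half_pow hη.le]; ring)
    rw [hUu ⟨hs.1, by linarith⟩, hUu ⟨by linarith [hs.1], hsb⟩,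
      hUu (x := s + k (n + 1)) ⟨by linarith [hs.1], by linarith⟩]
    exact h s _ hpos hs.1 hsb
  obtain ⟨v, hv⟩ := exists_tendstoUniformlyOn_of_dist_le_geometric (Real.sqrt_nonneg _)
    ((Real.sqrt_lt' one_pos).2 (by norm_num)) hstep
  have hv_cont : ContinuousOn v (Icc a b') :=
    hv.continuousOn (Frequently.of_forall fun n => Continuous.continuousOn (by fun_prop))
  refine contDiffOn_one_of_eq_const_add_integral (c := U a) hab hv_cont fun s hs => ?_
  rw [← sub_eq_integral_of_tendstoUniformlyOn_slope hU (tendsto_mul_half_pow hη) hv hs,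
    add_sub_cancel,
    hUu ⟨hs.1, hs.2.trans hb.le⟩]

end SecondDifference

end Calculus

section MinimizingCurves

open MeasureTheory
open scoped NNReal

variable {E : Type*} [NormedAddCommGroup E] [NormedSpace ℝ E]

/-- The length on `[a, b]` of a curve `w` in a normed space, with respect to a field `G` of bilinear
forms. The velocity is the derivative within `[a, b]`, so that it is also meaningful at the end
points. -/
noncomputable def arcLength (G : E → E →L[ℝ] E →L[ℝ] ℝ) (w : ℝ → E) (a b : ℝ) : ℝ :=
  ∫ t in a..b, √(G (w t) (derivWithin w (Icc a b) t) (derivWithin w (Icc a b) t))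

lemma arcLength_nonneg (G : E → E →L[ℝ] E →L[ℝ] ℝ) (w : ℝ → E) {a b : ℝ} (hab : a ≤ b) :
    0 ≤ arcLength G w a b :=
  intervalIntegral.integral_nonneg hab fun _ _ => Real.sqrt_nonneg _

/-- `G` is a smooth Riemannian metric on the convex open subset `B` of a normed space, with
explicit constants `κ` of ellipticity and `K` of distortion (how much the norms given by `G` at
two points of `B` may differ). -/
structure IsRiemannianOn (G : E → E →L[ℝ] E →L[ℝ] ℝ) (B : Set E) (κ K : ℝ) : Prop where
  isOpen : IsOpen B
  convex : Convex ℝ B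
  contDiffOn : ContDiffOn ℝ ∞ G B
  symm : ∀ y ∈ B, ∀ v w, G y v w = G y w v
  ellipticity_pos : 0 < κ
  ellipticity : ∀ y ∈ B, ∀ v, κ * ‖v‖ ≤ √(G y v v)
  distortion_nonneg : 0 ≤ K
  distortion : ∀ y ∈ B, ∀ z ∈ B, ∀ v, √(G y v v) ≤ (1 + K * ‖y - z‖) * √(G z v v)

/-- `u` is a curve in `B` which is parametrized by arclength and is not longer than any `C¹` curve
in `B` with the same end points. No regularity of `u` is assumed: that it has unit speed is
encoded by `chord_le`, according to which the chords of `u` are, up to higher order, not longer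
than its arcs. -/
structure IsMinimizingOn (G : E → E →L[ℝ] E →L[ℝ] ℝ) (B : Set E) (K : ℝ) (u : ℝ → E)
    (a b : ℝ) : Prop where
  mapsTo : MapsTo u (Icc a b) B
  le_arcLength : ∀ s ∈ Icc a b, ∀ s' ∈ Icc a b, s ≤ s' → ∀ (α β : ℝ) (w : ℝ → E), α ≤ β →
    ContDiffOn ℝ 1 w (Icc α β) → MapsTo w (Icc α β) B → w α = u s → w β = u s' →
    s' - s ≤ arcLength G w α β
  chord_le : ∀ s ∈ Icc a b, ∀ s' ∈ Icc a b, s ≤ s' → ∀ m ∈ B,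
    √(G m (u s' - u s) (u s' - u s)) ≤ (1 + K * (‖m - u s‖ + (s' - s))) * (s' - s)

variable {G : E → E →L[ℝ] E →L[ℝ] ℝ} {B : Set E} {κ K : ℝ}

lemma IsRiemannianOn.apply_self_nonneg (hG : IsRiemannianOn G B κ K) {y : E} (hy : y ∈ B) (v : E) :
    0 ≤ G y v v := by
  rcases eq_or_ne v 0 with rfl | hv
  · simp
  · exact (Real.sqrt_pos.1 <| (mul_pos hG.ellipticity_pos (norm_pos_iff.2 hv)).trans_le
      (hG.ellipticity y hy v)).le

lemma IsRiemannianOn.arcLength_segment_le (hG : IsRiemannianOn G B κ K) {x y m : E} {r : ℝ}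
    (hx : x ∈ B) (hy : y ∈ B) (hm : m ∈ B) (hxm : ‖x - m‖ ≤ r) (hym : ‖y - m‖ ≤ r) :
    arcLength G (fun t => x + t • (y - x)) 0 1 ≤ (1 + K * r) * √(G m (y - x) (y - x)) := by
  set w : ℝ → E := fun t => x + t • (y - x)
  have hderiv : ∀ t, HasDerivAt w (y - x) t := fun t => by
    simpa [w] using ((hasDerivAt_id t).smul_const (y - x)).const_add x
  have hmem : ∀ t ∈ Icc (0 : ℝ) 1, w t ∈ B ∩ Metric.closedBall m r := fun t ht =>
    (hG.convex.inter (convex_closedBall m r)).add_smul_sub_mem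
      ⟨hx, mem_closedBall_iff_norm.2 hxm⟩ ⟨hy, mem_closedBall_iff_norm.2 hym⟩ ht
  have hspeed : ∀ t ∈ uIoc (0 : ℝ) 1,
      ‖√(G (w t) (derivWithin w (Icc 0 1) t) (derivWithin w (Icc 0 1) t))‖ ≤
        (1 + K * r) * √(G m (y - x) (y - x)) := by
    intro t ht
    have ht' : t ∈ Icc (0 : ℝ) 1 := Ioc_subset_Icc_self (uIoc_of_le (zero_le_one' ℝ) ▸ ht)
    rw [(hderiv t).hasDerivWithinAt.derivWithin (uniqueDiffOn_Icc zero_lt_one t ht'),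
      Real.norm_of_nonneg (Real.sqrt_nonneg _)]
    refine (hG.distortion _ (hmem t ht').1 m hm _).trans ?_
    gcongr
    · exact hG.distortion_nonneg
    · exact mem_closedBall_iff_norm.1 (hmem t ht').2
  refine (Real.le_norm_self _).trans
    ((intervalIntegral.norm_integral_le_of_norm_le_const hspeed).trans_eq ?_)
  rw [sub_zero, abs_one, mul_one]

namespace IsMinimizingOn

variable {u : ℝ → E} {a b : ℝ}

lemma mono (hu : IsMinimizingOn G B K u a b) {α β : ℝ} (h : Icc α β ⊆ Icc a b) :
    IsMinimizingOn G B K u α β where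
  mapsTo := hu.mapsTo.mono_left h
  le_arcLength s hs s' hs' := hu.le_arcLength s (h hs) s' (h hs')
  chord_le s hs s' hs' := hu.chord_le s (h hs) s' (h hs')

lemma exists_lipschitzOnWith (hG : IsRiemannianOn G B κ K) (hu : IsMinimizingOn G B K u a b) :
    ∃ Λ, LipschitzOnWith Λ u (Icc a b) := by
  have dist_le : ∀ s ∈ Icc a b, ∀ s' ∈ Icc a b, s ≤ s' →
      dist (u s') (u s) ≤ (1 + K * (b - a)) / κ * dist s' s := by
    intro s hs s' hs' hss
    rw [Real.dist_eq, abs_of_nonneg (sub_nonneg.2 hss), dist_eq_norm, div_mul_eq_mul_div,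
      le_div_iff₀ hG.ellipticity_pos, mul_comm]
    refine (hG.ellipticity _ (hu.mapsTo hs) _).trans
      ((hu.chord_le s hs s' hs' hss _ (hu.mapsTo hs)).trans ?_)
    rw [sub_self, norm_zero, zero_add]
    have hK := hG.distortion_nonneg
    gcongr
    exacts [hs'.2, hs.1]
  refine ⟨_, LipschitzOnWith.of_dist_le' (K := (1 + K * (b - a)) / κ) fun s hs s' hs' => ?_⟩
  rcases le_total s s' with h | h
  · simpa only [dist_comm] using dist_le s hs s' hs' h
  · exact dist_le s' hs' s hs h

lemma continuousOn (hG : IsRiemannianOn G B κ K) (hu : IsMinimizingOn G B K u a b) :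
    ContinuousOn u (Icc a b) :=
  (hu.exists_lipschitzOnWith hG).elim fun _ h => h.continuousOn

lemma sub_le_chord (hG : IsRiemannianOn G B κ K) (hu : IsMinimizingOn G B K u a b) {s s' : ℝ}
    (hs : s ∈ Icc a b) (hs' : s' ∈ Icc a b) (hss : s ≤ s') {m : E} (hm : m ∈ B) {r : ℝ}
    (hsm : ‖u s - m‖ ≤ r) (hs'm : ‖u s' - m‖ ≤ r) :
    s' - s ≤ (1 + K * r) * √(G m (u s' - u s) (u s' - u s)) :=
  (hu.le_arcLength s hs s' hs' hss 0 1 (fun t => u s + t • (u s' - u s)) zero_le_one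
      (ContDiff.contDiffOn (by fun_prop))
      (fun _ ht => hG.convex.add_smul_sub_mem (hu.mapsTo hs) (hu.mapsTo hs') ht)
      (by simp) (by simp)).trans
    (hG.arcLength_segment_le (hu.mapsTo hs) (hu.mapsTo hs') hm hsm hs'm)

lemma chord_le_abs (hG : IsRiemannianOn G B κ K) (hu : IsMinimizingOn G B K u a b) {s s' : ℝ}
    (hs : s ∈ Icc a b) (hs' : s' ∈ Icc a b) :
    √(G (u s) (u s' - u s) (u s' - u s)) ≤ (1 + K * (‖u s - u s'‖ + |s' - s|)) * |s' - s| := by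
  have hK := hG.distortion_nonneg
  rcases le_total s s' with h | h
  · rw [abs_of_nonneg (sub_nonneg.2 h)]
    refine (hu.chord_le s hs s' hs' h (u s) (hu.mapsTo hs)).trans ?_
    rw [sub_self, norm_zero]
    gcongr
    exact norm_nonneg _
  · rw [abs_sub_comm, abs_of_nonneg (sub_nonneg.2 h), ← neg_sub (u s) (u s')]
    simpa only [map_neg, _root_.neg_apply, neg_neg] using
      hu.chord_le s' hs' s hs h (u s) (hu.mapsTo hs)

lemma speed_le (hG : IsRiemannianOn G B κ K) (hu : IsMinimizingOn G B K u a b) (hab : a < b)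
    (hd : DifferentiableOn ℝ u (Icc a b)) {s : ℝ} (hs : s ∈ Icc a b) :
    G (u s) (derivWithin u (Icc a b) s) (derivWithin u (Icc a b) s) ≤ 1 := by
  set v := derivWithin u (Icc a b) s
  have hv : HasDerivWithinAt u v (Icc a b) s := (hd s hs).hasDerivWithinAt
  have : (𝓝[Icc a b \ {s}] s).NeBot :=
    accPt_principal_iff_nhdsWithin.1 (uniqueDiffOn_Icc hab s hs).accPt
  have hslope : Tendsto (fun s' => √(G (u s) (slope u s s') (slope u s s')))
      (𝓝[Icc a b \ {s}] s) (𝓝 √(G (u s) v v)) := by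
    have hcont : Continuous fun z : E => √(G (u s) z z) := by fun_prop
    exact (hcont.tendsto v).comp (hasDerivWithinAt_iff_tendsto_slope.1 hv)
  have hbound : Tendsto (fun s' => 1 + K * (‖u s - u s'‖ + |s' - s|)) (𝓝[Icc a b \ {s}] s)
      (𝓝 1) := by
    have hcont : ContinuousWithinAt (fun s' => 1 + K * (‖u s - u s'‖ + |s' - s|)) (Icc a b) s := by
      have := hv.continuousWithinAt
      fun_prop
    simpa using hcont.tendsto.mono_left (nhdsWithin_mono _ sdiff_subset)
  refine Real.sqrt_le_one.1 (le_of_tendsto_of_tendsto hslope hbound ?_)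
  filter_upwards [self_mem_nhdsWithin] with s' hs'
  simp only [slope_def_module, map_smul, _root_.smul_apply, smul_eq_mul]
  rw [← mul_assoc, ← sq, Real.sqrt_mul (sq_nonneg _), Real.sqrt_sq_eq_abs, abs_inv,
    inv_mul_le_iff₀ (abs_pos.2 (sub_ne_zero.2 hs'.2)), mul_comm]
  exact hu.chord_le_abs hG hs hs'.1

end IsMinimizingOn

section SecondDifference

lemma parallelogram_apply (L : E →L[ℝ] E →L[ℝ] ℝ) (x m y : E) :
    L (y - (2 : ℝ) • m + x) (y - (2 : ℝ) • m + x) =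
      2 * L (y - m) (y - m) + 2 * L (m - x) (m - x) - L (y - x) (y - x) := by
  have hdiff : y - (2 : ℝ) • m + x = (y - m) - (m - x) := by module
  have hsum : y - x = (y - m) + (m - x) := by abel
  rw [hdiff, hsum]
  simp only [map_sub, map_add, _root_.sub_apply, _root_.add_apply]
  ring

lemma sq_mul_one_sub_two_mul_le {δ l S : ℝ} (hδ : 0 ≤ δ) (hl : 0 ≤ l) (hS : 0 ≤ S)
    (h : l ≤ (1 + δ) * √S) : l ^ 2 * (1 - 2 * δ) ≤ S := by
  have hsq : l ^ 2 ≤ (1 + δ) ^ 2 * S := by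
    simpa only [mul_pow, Real.sq_sqrt hS] using pow_le_pow_left₀ hl h 2
  rcases le_or_gt (1 - 2 * δ) 0 with hδ' | hδ'
  · exact (mul_nonpos_of_nonneg_of_nonpos (sq_nonneg l) hδ').trans hS
  · calc l ^ 2 * (1 - 2 * δ) ≤ (1 + δ) ^ 2 * S * (1 - 2 * δ) := by gcongr
      _ = (1 + δ) ^ 2 * (1 - 2 * δ) * S := by ring
      _ ≤ 1 * S := by
        gcongr
        nlinarith [mul_nonneg hδ (sq_nonneg δ), sq_nonneg δ]
      _ = S := one_mul S

variable {u : ℝ → E} {a b : ℝ}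

/-- If `m` were not a midpoint of `x` and `y` up to higher order, then by the parallelogram identity
the chord from `x` to `y` would be shorter than the minimizing arc. -/
lemma IsMinimizingOn.apply_second_difference_le (hG : IsRiemannianOn G B κ K)
    (hu : IsMinimizingOn G B K u a b) {Λ : ℝ≥0} (hΛ : LipschitzOnWith Λ u (Icc a b)) {s k : ℝ}
    (hk : 0 ≤ k) (hs : a ≤ s) (hsb : s + 2 * k ≤ b) :
    let d := u (s + 2 * k) - (2 : ℝ) • u (s + k) + u s
    G (u (s + k)) d d ≤ 4 * k ^ 2 * (K * (Λ + 1) * k * (4 + K * (Λ + 1) * k)) := by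
  intro d
  have hK := hG.distortion_nonneg
  have hx : s ∈ Icc a b := ⟨hs, by linarith⟩
  have hm : s + k ∈ Icc a b := ⟨by linarith, by linarith⟩
  have hy : s + 2 * k ∈ Icc a b := ⟨by linarith, hsb⟩
  have hmB := hu.mapsTo hm
  have hxm : ‖u s - u (s + k)‖ ≤ Λ * k := by
    simpa [Real.dist_eq, abs_of_nonneg hk] using hΛ.norm_sub_le hx hm
  have hym : ‖u (s + 2 * k) - u (s + k)‖ ≤ Λ * k := by
    have hdiff : s + 2 * k - (s + k) = k := by ring
    simpa only [hdiff, Real.norm_of_nonneg hk] using hΛ.norm_sub_le hy hm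
  set δ := K * (Λ + 1) * k with hδ
  have hδ0 : 0 ≤ δ := by positivity
  have first_half : G (u (s + k)) (u (s + k) - u s) (u (s + k) - u s) ≤ ((1 + δ) * k) ^ 2 := by
    refine (Real.sqrt_le_iff.1 ((hu.chord_le _ hx _ hm (by linarith) _ hmB).trans ?_)).2
    rw [add_sub_cancel_left, norm_sub_rev, hδ, mul_assoc K, add_one_mul (Λ : ℝ)]
    gcongr
  have second_half : G (u (s + k)) (u (s + 2 * k) - u (s + k)) (u (s + 2 * k) - u (s + k)) ≤
      ((1 + δ) * k) ^ 2 := by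
    refine (Real.sqrt_le_iff.1 ((hu.chord_le _ hm _ hy (by linarith) _ hmB).trans ?_)).2
    rw [add_sub_add_left_eq_sub, two_mul, add_sub_cancel_right, sub_self, norm_zero, hδ,
      mul_assoc K, add_one_mul (Λ : ℝ)]
    gcongr
    positivity
  have whole : (2 * k) ^ 2 * (1 - 2 * δ) ≤
      G (u (s + k)) (u (s + 2 * k) - u s) (u (s + 2 * k) - u s) := by
    refine sq_mul_one_sub_two_mul_le hδ0 (by positivity) (hG.apply_self_nonneg hmB _) ?_
    have hchord := hu.sub_le_chord hG hx hy (by linarith) hmB hxm hym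
    rw [add_sub_cancel_left] at hchord
    refine hchord.trans ?_
    rw [hδ, mul_assoc K, add_one_mul (Λ : ℝ)]
    gcongr
    linarith
  rw [parallelogram_apply]
  linarith

lemma IsMinimizingOn.exists_second_difference_le (hG : IsRiemannianOn G B κ K)
    (hu : IsMinimizingOn G B K u a b) :
    ∃ C, ∀ s k, 0 < k → a ≤ s → s + 2 * k ≤ b →
      ‖u (s + 2 * k) - (2 : ℝ) • u (s + k) + u s‖ ≤ C * (k * √k) := by
  obtain ⟨Λ, hΛ⟩ := hu.exists_lipschitzOnWith hG
  have hκ := hG.ellipticity_pos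
  have hK := hG.distortion_nonneg
  set A := 4 * (K * (Λ + 1)) * (4 + K * (Λ + 1) * (b - a))
  refine ⟨√A / κ, fun s k hk hs hsb => ?_⟩
  have hm : u (s + k) ∈ B := hu.mapsTo ⟨by linarith, by linarith⟩
  have hA : 0 ≤ A := by
    have : 0 ≤ b - a := by linarith
    positivity
  rw [div_mul_eq_mul_div, le_div_iff₀ hκ, mul_comm]
  refine (hG.ellipticity _ hm _).trans (Real.sqrt_le_iff.2 ⟨by positivity, ?_⟩)
  calc _ ≤ 4 * k ^ 2 * (K * (Λ + 1) * k * (4 + K * (Λ + 1) * k)) :=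
        hu.apply_second_difference_le hG hΛ hk.le hs hsb
    _ ≤ 4 * k ^ 2 * (K * (Λ + 1) * k * (4 + K * (Λ + 1) * (b - a))) := by
        gcongr
        linarith
    _ = A * (k ^ 2 * k) := by ring
    _ = (√A * (k * √k)) ^ 2 := by rw [mul_pow, mul_pow, Real.sq_sqrt hA, Real.sq_sqrt hk.le]

theorem IsMinimizingOn.contDiffOn_one [CompleteSpace E] (hG : IsRiemannianOn G B κ K)
    (hu : IsMinimizingOn G B K u a b) {β : ℝ} (ha : a < β) (hb : β < b) :
    ContDiffOn ℝ 1 u (Icc a β) :=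
  (hu.exists_second_difference_le hG).elim fun _ hC =>
    contDiffOn_one_of_second_difference_le ha hb (hu.continuousOn hG) hC

end SecondDifference

end MinimizingCurves

section EulerLagrange

set_option maxSynthPendingDepth 3

open MeasureTheory

variable {E : Type*} [NormedAddCommGroup E] [NormedSpace ℝ E]
  {G : E → E →L[ℝ] E →L[ℝ] ℝ} {B : Set E} {κ K : ℝ} {u : ℝ → E} {a b : ℝ}

section Energy

/-- The energy on `[a, b]` of a curve `w` in a normed space, with respect to a field `G` of bilinear
forms: the integrand of `arcLength` without the square root. -/
noncomputable def arcEnergy (G : E → E →L[ℝ] E →L[ℝ] ℝ) (w : ℝ → E) (a b : ℝ) : ℝ :=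
  ∫ t in a..b, G (w t) (derivWithin w (Icc a b) t) (derivWithin w (Icc a b) t)

lemma continuousOn_apply_derivWithin {w : ℝ → E} (hG : ContinuousOn G B) (hab : a < b)
    (hw : ContDiffOn ℝ 1 w (Icc a b)) (hwB : MapsTo w (Icc a b) B) :
    ContinuousOn (fun t => G (w t) (derivWithin w (Icc a b) t) (derivWithin w (Icc a b) t))
      (Icc a b) := by
  have hw' := hw.continuousOn_derivWithin (uniqueDiffOn_Icc hab) le_rfl
  have hGw := hG.comp hw.continuousOn hwB
  exact (hGw.clm_apply hw').clm_apply hw'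

lemma IsRiemannianOn.two_mul_arcLength_le (hG : IsRiemannianOn G B κ K) (hab : a < b) {w : ℝ → E}
    (hw : ContDiffOn ℝ 1 w (Icc a b)) (hwB : MapsTo w (Icc a b) B) :
    2 * arcLength G w a b ≤ b - a + arcEnergy G w a b := by
  have hcont := continuousOn_apply_derivWithin hG.contDiffOn.continuousOn hab hw hwB
  have hint := hcont.intervalIntegrable_of_Icc (μ := volume) hab.le
  have hone : b - a = ∫ _ in a..b, (1 : ℝ) := by simp
  rw [arcLength, arcEnergy, hone, ← intervalIntegral.integral_const_mul,
    ← intervalIntegral.integral_add intervalIntegrable_const hint]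
  refine intervalIntegral.integral_mono_on hab.le
    ((hcont.sqrt.intervalIntegrable_of_Icc hab.le).const_mul 2)
    (intervalIntegrable_const.add hint) fun t ht => ?_
  linarith [two_mul_le_add_sq 1 √(G (w t) (derivWithin w (Icc a b) t) (derivWithin w (Icc a b) t)),
    Real.sq_sqrt (hG.apply_self_nonneg (hwB ht) (derivWithin w (Icc a b) t))]

lemma IsMinimizingOn.sub_le_arcEnergy (hG : IsRiemannianOn G B κ K)
    (hu : IsMinimizingOn G B K u a b) (hab : a < b) {w : ℝ → E} (hw : ContDiffOn ℝ 1 w (Icc a b))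
    (hwB : MapsTo w (Icc a b) B) (hwa : w a = u a) (hwb : w b = u b) :
    b - a ≤ arcEnergy G w a b := by
  have hle := hu.le_arcLength a (left_mem_Icc.2 hab.le) b (right_mem_Icc.2 hab.le) hab.le a b w
    hab.le hw hwB hwa hwb
  linarith [hG.two_mul_arcLength_le hab hw hwB]

lemma IsMinimizingOn.arcEnergy_le (hG : IsRiemannianOn G B κ K)
    (hu : IsMinimizingOn G B K u a b) (hab : a < b) (hd : ContDiffOn ℝ 1 u (Icc a b)) :
    arcEnergy G u a b ≤ b - a := by
  have hint := (continuousOn_apply_derivWithin hG.contDiffOn.continuousOn hab hd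
    hu.mapsTo).intervalIntegrable_of_Icc (μ := volume) hab.le
  calc arcEnergy G u a b ≤ ∫ _ in a..b, (1 : ℝ) :=
        intervalIntegral.integral_mono_on hab.le hint intervalIntegrable_const fun t ht =>
          hu.speed_le hG hab (hd.differentiableOn one_ne_zero) ht
    _ = b - a := by simp

end Energy

section FirstVariation

lemma exists_forall_add_smul_mem {η : ℝ → E} (hB : IsOpen B) (hu : ContinuousOn u (Icc a b))
    (huB : MapsTo u (Icc a b) B) (hη : ContinuousOn η (Icc a b)) :
    ∃ δ : ℝ, 0 < δ ∧ ∀ ε ∈ Icc (-δ) δ, ∀ t ∈ Icc a b, u t + ε • η t ∈ B := by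
  obtain ⟨ρ, hρ, hsub⟩ := (isCompact_Icc.image_of_continuousOn hu).exists_cthickening_subset_open
    hB huB.image_subset
  obtain ⟨C, hC⟩ := isCompact_Icc.exists_bound_of_continuousOn hη
  refine ⟨ρ / (|C| + 1), by positivity, fun ε hε t ht => hsub ?_⟩
  refine Metric.mem_cthickening_of_dist_le _ (u t) _ _ (mem_image_of_mem u ht) ?_
  rw [dist_eq_norm, add_sub_cancel_left, norm_smul, Real.norm_eq_abs]
  calc |ε| * ‖η t‖ ≤ ρ / (|C| + 1) * (|C| + 1) := by
        gcongr
        · exact abs_le.2 hε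
        · linarith [hC t ht, le_abs_self C]
    _ = ρ := div_mul_cancel₀ ρ (by positivity)

lemma hasDerivAt_apply_self_add_smul {y v η η' : E} {ε : ℝ}
    (hG : DifferentiableAt ℝ G (y + ε • η)) :
    HasDerivAt (fun x : ℝ => G (y + x • η) (v + x • η') (v + x • η'))
      (fderiv ℝ G (y + ε • η) η (v + ε • η') (v + ε • η') + G (y + ε • η) η' (v + ε • η') +
        G (y + ε • η) (v + ε • η') η') ε := by
  have hline : ∀ p d : E, HasDerivAt (fun x : ℝ => p + x • d) d ε := fun p d => by
    simpa using ((hasDerivAt_id ε).smul_const d).const_add p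
  have hGline : HasDerivAt (fun x : ℝ => G (y + x • η)) (fderiv ℝ G (y + ε • η) η) ε :=
    hG.hasFDerivAt.comp_hasDerivAt ε (hline y η)
  simpa only [_root_.add_apply] using (hGline.clm_apply (hline v η')).clm_apply (hline v η')

lemma hasDerivAt_integral_apply_self_add_smul {v η η' : ℝ → E} (hB : IsOpen B)
    (hG : ContDiffOn ℝ 1 G B) (hsymm : ∀ y ∈ B, ∀ v w, G y v w = G y w v) (hab : a ≤ b)
    (hu : ContinuousOn u (Icc a b)) (huB : MapsTo u (Icc a b) B) (hv : ContinuousOn v (Icc a b))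
    (hη : ContinuousOn η (Icc a b)) (hη' : ContinuousOn η' (Icc a b)) :
    HasDerivAt
      (fun ε : ℝ => ∫ t in a..b, G (u t + ε • η t) (v t + ε • η' t) (v t + ε • η' t))
      (∫ t in a..b, (fderiv ℝ G (u t) (η t) (v t) (v t) + 2 * G (u t) (v t) (η' t))) 0 := by
  obtain ⟨δ, hδ, hδB⟩ := exists_forall_add_smul_mem hB hu huB hη
  have comp_snd {w : ℝ → E} (hw : ContinuousOn w (Icc a b)) :
      ContinuousOn (fun x : ℝ × ℝ => w x.2) (Icc (-δ) δ ×ˢ Icc a b) :=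
    hw.comp continuousOn_snd fun _ hx => hx.2
  have line_continuousOn {p d : ℝ → E} (hp : ContinuousOn p (Icc a b))
      (hd : ContinuousOn d (Icc a b)) :
      ContinuousOn (fun x : ℝ × ℝ => p x.2 + x.1 • d x.2) (Icc (-δ) δ ×ˢ Icc a b) :=
    (comp_snd hp).add (continuousOn_fst.smul (comp_snd hd))
  have hvη' := line_continuousOn hv hη'
  have huηB : MapsTo (fun x : ℝ × ℝ => u x.2 + x.1 • η x.2) (Icc (-δ) δ ×ˢ Icc a b) B :=
    fun x hx => hδB x.1 hx.1 x.2 hx.2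
  have hGc := hG.continuousOn.comp (line_continuousOn hu hη) huηB
  have hG'c := (hG.continuousOn_fderiv_of_isOpen hB le_rfl).comp (line_continuousOn hu hη) huηB
  have hderiv := hasDerivAt_integral_param_of_continuousOn hab hδ
    (F := fun ε t => G (u t + ε • η t) (v t + ε • η' t) (v t + ε • η' t))
    (F' := fun ε t => fderiv ℝ G (u t + ε • η t) (η t) (v t + ε • η' t) (v t + ε • η' t) +
      G (u t + ε • η t) (η' t) (v t + ε • η' t) + G (u t + ε • η t) (v t + ε • η' t) (η' t))
    ((hGc.clm_apply hvη').clm_apply hvη')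
    (((((hG'c.clm_apply (comp_snd hη)).clm_apply hvη').clm_apply hvη').add
      ((hGc.clm_apply (comp_snd hη')).clm_apply hvη')).add
      ((hGc.clm_apply hvη').clm_apply (comp_snd hη')))
    fun t ht ε hε => hasDerivAt_apply_self_add_smul <|
      (hG.differentiableOn one_ne_zero).differentiableAt <|
        hB.mem_nhds (hδB ε (Ioo_subset_Icc_self hε) t ht)
  refine hderiv.congr_deriv (intervalIntegral.integral_congr fun t ht => ?_)
  simp only [zero_smul, add_zero]
  rw [hsymm _ (huB (uIcc_of_le hab ▸ ht)) (η' t), two_mul, add_assoc]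

lemma arcEnergy_add_smul {η η' : ℝ → E} (hab : a < b) (hu : DifferentiableOn ℝ u (Icc a b))
    (hη : ∀ t ∈ Icc a b, HasDerivWithinAt η (η' t) (Icc a b) t) (ε : ℝ) :
    arcEnergy G (fun t => u t + ε • η t) a b =
      ∫ t in a..b, G (u t + ε • η t) (derivWithin u (Icc a b) t + ε • η' t)
        (derivWithin u (Icc a b) t + ε • η' t) := by
  refine intervalIntegral.integral_congr fun t ht => ?_
  rw [uIcc_of_le hab.le] at ht
  have hderiv := (hu t ht).hasDerivWithinAt.add ((hη t ht).const_smul ε)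
  simp only [← hderiv.derivWithin (uniqueDiffOn_Icc hab t ht)]
  rfl

lemma IsMinimizingOn.first_variation (hG : IsRiemannianOn G B κ K)
    (hu : IsMinimizingOn G B K u a b) (hab : a < b) (hd : ContDiffOn ℝ 1 u (Icc a b))
    {η η' : ℝ → E} (hη : ∀ t, HasDerivAt η (η' t) t) (hη' : Continuous η')
    (hηa : η a = 0) (hηb : η b = 0) :
    ∫ t in a..b, (fderiv ℝ G (u t) (η t) (derivWithin u (Icc a b) t) (derivWithin u (Icc a b) t) +
      2 * G (u t) (derivWithin u (Icc a b) t) (η' t)) = 0 := by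
  have hη_smooth : ContDiff ℝ 1 η := contDiff_one_iff_deriv.2
    ⟨fun t => (hη t).differentiableAt, by rwa [funext fun t => (hη t).deriv]⟩
  have hvariation : ∀ ε, arcEnergy G (fun t => u t + ε • η t) a b = _ :=
    arcEnergy_add_smul hab (hd.differentiableOn one_ne_zero) fun t _ => (hη t).hasDerivWithinAt
  have hderiv := hasDerivAt_integral_apply_self_add_smul hG.isOpen
    (hG.contDiffOn.of_le (by simp)) hG.symm hab.le hd.continuousOn hu.mapsTo
    (hd.continuousOn_derivWithin (uniqueDiffOn_Icc hab) le_rfl) hη_smooth.continuous.continuousOn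
    hη'.continuousOn
  simp only [← hvariation] at hderiv
  refine IsLocalMin.hasDerivAt_eq_zero ?_ hderiv
  obtain ⟨δ, hδ, hδB⟩ := exists_forall_add_smul_mem hG.isOpen hd.continuousOn hu.mapsTo
    hη_smooth.continuous.continuousOn
  filter_upwards [Icc_mem_nhds (neg_lt_zero.2 hδ) hδ] with ε hε
  simp only [zero_smul, add_zero]
  exact (hu.arcEnergy_le hG hab hd).trans <| hu.sub_le_arcEnergy hG hab
    (hd.add (hη_smooth.const_smul ε).contDiffOn) (hδB ε hε) (by simp [hηa]) (by simp [hηb])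

/-- The geodesic equation, in terms of the momentum `G (u, u')`. -/
lemma IsMinimizingOn.hasDerivWithinAt_momentum (hG : IsRiemannianOn G B κ K)
    (hu : IsMinimizingOn G B K u a b) (hab : a < b) (hd : ContDiffOn ℝ 1 u (Icc a b))
    (w : E) {t : ℝ} (ht : t ∈ Icc a b) :
    HasDerivWithinAt (fun t => G (u t) (derivWithin u (Icc a b) t) w)
      (2⁻¹ * fderiv ℝ G (u t) w (derivWithin u (Icc a b) t) (derivWithin u (Icc a b) t))
      (Icc a b) t := by
  set v := derivWithin u (Icc a b)
  have hv : ContinuousOn v (Icc a b) := hd.continuousOn_derivWithin (uniqueDiffOn_Icc hab) le_rfl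
  have hGu := hG.contDiffOn.continuousOn.comp hd.continuousOn hu.mapsTo
  have hG'u := (hG.contDiffOn.continuousOn_fderiv_of_isOpen hG.isOpen (by simp)).comp
    hd.continuousOn hu.mapsTo
  have hforce : ContinuousOn (fun t => fderiv ℝ G (u t) w (v t) (v t)) (Icc a b) :=
    ((hG'u.clm_apply continuousOn_const).clm_apply hv).clm_apply hv
  obtain ⟨c, hc⟩ := exists_eq_const_add_integral_of_forall_integral_eq_zero hab
    (((hGu.clm_apply hv).clm_apply continuousOn_const).const_mul 2) hforce
    fun f f' hf hf' hfa hfb => by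
      have hfw := hu.first_variation hG hab hd (fun t => (hf t).smul_const w)
        (hf'.smul continuous_const) (by simp [hfa]) (by simp [hfb])
      rw [← hfw]
      refine intervalIntegral.integral_congr fun t _ => ?_
      simp only [map_smul, _root_.smul_apply, smul_eq_mul, Function.comp_apply, v]
      ring
  have hmomentum : ∀ s ∈ Icc a b,
      G (u s) (v s) w = 2⁻¹ * (c + ∫ x in a..s, fderiv ℝ G (u x) w (v x) (v x)) := fun s hs => by
    rw [← hc s hs, Function.comp_apply, inv_mul_cancel_left₀ two_ne_zero]
  exact (((hasDerivWithinAt_integral_of_continuousOn_Icc hforce ht).const_add c).const_mul _).congr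
    hmomentum (hmomentum t ht)

end FirstVariation

section Regularity

variable [FiniteDimensional ℝ E]

lemma IsRiemannianOn.isInvertible (hG : IsRiemannianOn G B κ K) {y : E} (hy : y ∈ B) :
    (G y).IsInvertible := by
  have hfin : Module.finrank ℝ E = Module.finrank ℝ (E →L[ℝ] ℝ) :=
    Subspace.dual_finrank_eq.symm.trans
      (LinearMap.toContinuousLinearMap (𝕜 := ℝ) (E := E) (F' := ℝ)).finrank_eq
  have hinj : Function.Injective (G y : E →ₗ[ℝ] (E →L[ℝ] ℝ)) := by
    refine (injective_iff_map_eq_zero _).2 fun v hv => norm_le_zero_iff.1 ?_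
    have hv' : G y v = 0 := hv
    have hle := hG.ellipticity y hy v
    rw [hv', _root_.zero_apply, Real.sqrt_zero] at hle
    exact nonpos_of_mul_nonpos_right hle hG.ellipticity_pos
  exact ⟨(LinearMap.linearEquivOfInjective _ hinj hfin).toContinuousLinearEquiv,
    ContinuousLinearMap.ext fun v => rfl⟩

lemma IsMinimizingOn.contDiffOn_momentum (hG : IsRiemannianOn G B κ K)
    (hu : IsMinimizingOn G B K u a b) (hab : a < b) (hd : ContDiffOn ℝ 1 u (Icc a b)) {n : ℕ}
    (hn : ContDiffOn ℝ n (derivWithin u (Icc a b)) (Icc a b)) :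
    ContDiffOn ℝ (n + 1) (fun t => G (u t) (derivWithin u (Icc a b) t)) (Icc a b) := by
  have hud := uniqueDiffOn_Icc hab
  have hun : ContDiffOn ℝ n u (Icc a b) :=
    ((contDiffOn_succ_iff_derivWithin hud).2
      ⟨hd.differentiableOn one_ne_zero, by simp, hn⟩).of_le le_self_add
  have hG' : ContDiffOn ℝ n (fderiv ℝ G) B :=
    hG.contDiffOn.fderiv_of_isOpen hG.isOpen (by exact_mod_cast le_top)
  refine contDiffOn_clm_apply.2 fun w => (contDiffOn_succ_iff_derivWithin hud).2
    ⟨fun t ht => (hu.hasDerivWithinAt_momentum hG hab hd w ht).differentiableWithinAt, by simp, ?_⟩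
  refine ContDiffOn.congr ?_ fun t ht =>
    (hu.hasDerivWithinAt_momentum hG hab hd w ht).derivWithin (hud t ht)
  exact contDiffOn_const.mul ((((hG'.comp hun hu.mapsTo).clm_apply
    contDiffOn_const).clm_apply hn).clm_apply hn)

/-- The velocity is recovered from the momentum, which by the geodesic equation is one degree
smoother, through the inverse of the metric. -/
lemma IsMinimizingOn.contDiffOn_derivWithin (hG : IsRiemannianOn G B κ K)
    (hu : IsMinimizingOn G B K u a b) (hab : a < b) (hd : ContDiffOn ℝ 1 u (Icc a b)) (n : ℕ) :
    ContDiffOn ℝ n (derivWithin u (Icc a b)) (Icc a b) := by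
  have hud := uniqueDiffOn_Icc hab
  induction n with
  | zero => exact contDiffOn_zero.2 (hd.continuousOn_derivWithin hud le_rfl)
  | succ n ih =>
    have hu_succ : ContDiffOn ℝ (n + 1) u (Icc a b) :=
      (contDiffOn_succ_iff_derivWithin hud).2 ⟨hd.differentiableOn one_ne_zero, by simp, ih⟩
    have hGu : ContDiffOn ℝ (n + 1) (fun t => G (u t)) (Icc a b) :=
      (hG.contDiffOn.of_le (by exact_mod_cast le_top)).comp hu_succ hu.mapsTo
    have hinv : ContDiffOn ℝ (n + 1) (fun t => (G (u t)).inverse) (Icc a b) := fun t ht =>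
      ContDiffAt.comp_contDiffWithinAt (g := ContinuousLinearMap.inverse) t
        (hG.isInvertible (hu.mapsTo ht)).contDiffAt_map_inverse (hGu t ht)
    rw [Nat.cast_succ]
    exact (hinv.clm_apply (hu.contDiffOn_momentum hG hab hd ih)).congr fun t ht =>
      ((hG.isInvertible (hu.mapsTo ht)).inverse_apply_self _).symm

theorem IsMinimizingOn.contDiffOn (hG : IsRiemannianOn G B κ K)
    (hu : IsMinimizingOn G B K u a b) {β : ℝ} (ha : a < β) (hb : β < b) :
    ContDiffOn ℝ ∞ u (Icc a β) := by
  have hd : ContDiffOn ℝ 1 u (Icc a β) := hu.contDiffOn_one hG ha hb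
  have hv := (hu.mono (Icc_subset_Icc_right hb.le)).contDiffOn_derivWithin hG ha hd
  refine contDiffOn_infty.2 fun n => ContDiffOn.of_le ?_ (le_self_add (b := (1 : WithTop ℕ∞)))
  exact (contDiffOn_succ_iff_derivWithin (uniqueDiffOn_Icc ha)).2
    ⟨hd.differentiableOn one_ne_zero, by simp, hv n⟩

end Regularity

end EulerLagrange

section LocalMetric

set_option maxSynthPendingDepth 3

open MeasureTheory

variable {E : Type*} [NormedAddCommGroup E] [NormedSpace ℝ E]
  {G : E → E →L[ℝ] E →L[ℝ] ℝ} {B : Set E} {κ K : ℝ}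

namespace IsRiemannianOn

lemma mono_distortion (hG : IsRiemannianOn G B κ K) {K' : ℝ} (h : K ≤ K') :
    IsRiemannianOn G B κ K' where
  __ := hG
  distortion_nonneg := hG.distortion_nonneg.trans h
  distortion y hy z hz v := (hG.distortion y hy z hz v).trans (by gcongr)

lemma apply_le_sqrt_mul_sqrt (hG : IsRiemannianOn G B κ K) {m : E} (hm : m ∈ B)
    (v w : E) : G m v w ≤ √(G m v v) * √(G m w w) := by
  have h : G m v w * G m w v ≤ G m v v * G m w w :=
    LinearMap.BilinForm.apply_mul_apply_le_of_forall_zero_le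
      (ContinuousLinearMap.coeLM ℝ ∘ₗ (G m : E →ₗ[ℝ] (E →L[ℝ] ℝ)) : LinearMap.BilinForm ℝ E)
      (fun x => hG.apply_self_nonneg hm x) v w
  rw [hG.symm m hm w v, ← sq] at h
  rw [← Real.sqrt_mul (hG.apply_self_nonneg hm v)]
  exact (le_abs_self _).trans (Real.abs_le_sqrt h)

variable [CompleteSpace E] {w : ℝ → E} {a b : ℝ}

lemma mul_norm_sub_le_arcLength (hG : IsRiemannianOn G B κ K) (hab : a < b)
    (hw : ContDiffOn ℝ 1 w (Icc a b)) (hwB : MapsTo w (Icc a b) B) {τ : ℝ} (hτ : τ ∈ Icc a b) :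
    κ * ‖w τ - w a‖ ≤ arcLength G w a b := by
  have hsub : Icc a τ ⊆ Icc a b := Icc_subset_Icc_right hτ.2
  have hw' := hw.continuousOn_derivWithin (uniqueDiffOn_Icc hab) le_rfl
  have hspeed := (continuousOn_apply_derivWithin hG.contDiffOn.continuousOn hab hw hwB).sqrt
  have hFTC : ∫ t in a..τ, derivWithin w (Icc a b) t = w τ - w a :=
    intervalIntegral.integral_eq_sub_of_hasDerivAt_of_le hτ.1 (hw.continuousOn.mono hsub)
      (fun t ht => ((hw.differentiableOn one_ne_zero t
        ⟨ht.1.le, ht.2.le.trans hτ.2⟩).hasDerivWithinAt).hasDerivAt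
          (Icc_mem_nhds ht.1 (ht.2.trans_le hτ.2)))
      ((hw'.mono hsub).intervalIntegrable_of_Icc hτ.1)
  calc κ * ‖w τ - w a‖ ≤ κ * ∫ t in a..τ, ‖derivWithin w (Icc a b) t‖ := by
        rw [← hFTC]
        have hκ := hG.ellipticity_pos
        gcongr
        exact intervalIntegral.norm_integral_le_integral_norm hτ.1
    _ = ∫ t in a..τ, κ * ‖derivWithin w (Icc a b) t‖ :=
        (intervalIntegral.integral_const_mul _ _).symm
    _ ≤ ∫ t in a..τ, √(G (w t) (derivWithin w (Icc a b) t) (derivWithin w (Icc a b) t)) :=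
        intervalIntegral.integral_mono_on hτ.1
          (((hw'.norm.mono hsub).intervalIntegrable_of_Icc hτ.1).const_mul κ)
          ((hspeed.mono hsub).intervalIntegrable_of_Icc hτ.1)
          fun t ht => hG.ellipticity _ (hwB (hsub ht)) _
    _ ≤ arcLength G w a b :=
        intervalIntegral.integral_mono_interval le_rfl hτ.1 hτ.2
          (Eventually.of_forall fun _ => Real.sqrt_nonneg _)
          (hspeed.intervalIntegrable_of_Icc hab.le)

lemma sqrt_apply_derivWithin_le (hG : IsRiemannianOn G B κ K) (hab : a < b)
    (hw : ContDiffOn ℝ 1 w (Icc a b)) (hwB : MapsTo w (Icc a b) B) {m : E} (hm : m ∈ B) {t : ℝ}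
    (ht : t ∈ Icc a b) :
    √(G m (derivWithin w (Icc a b) t) (derivWithin w (Icc a b) t)) ≤
      (1 + K * (‖m - w a‖ + arcLength G w a b / κ)) *
        √(G (w t) (derivWithin w (Icc a b) t) (derivWithin w (Icc a b) t)) := by
  have hclose : ‖w t - w a‖ ≤ arcLength G w a b / κ :=
    (le_div_iff₀' hG.ellipticity_pos).2 (hG.mul_norm_sub_le_arcLength hab hw hwB ht)
  have htriangle := norm_sub_le_norm_sub_add_norm_sub m (w a) (w t)
  rw [norm_sub_rev (w a)] at htriangle
  have hK := hG.distortion_nonneg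
  refine (hG.distortion m hm _ (hwB ht) _).trans ?_
  gcongr
  exact htriangle.trans (by gcongr)

lemma chord_le_arcLength (hG : IsRiemannianOn G B κ K) (hab : a < b)
    (hw : ContDiffOn ℝ 1 w (Icc a b)) (hwB : MapsTo w (Icc a b) B) {m : E} (hm : m ∈ B) :
    √(G m (w b - w a) (w b - w a)) ≤
      (1 + K * (‖m - w a‖ + arcLength G w a b / κ)) * arcLength G w a b := by
  set C := 1 + K * (‖m - w a‖ + arcLength G w a b / κ)
  have hw' := hw.continuousOn_derivWithin (uniqueDiffOn_Icc hab) le_rfl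
  have hspeed := (continuousOn_apply_derivWithin hG.contDiffOn.continuousOn hab hw hwB).sqrt
  have hlength := arcLength_nonneg G w hab.le
  set Δ := w b - w a
  have hsq : √(G m Δ Δ) * √(G m Δ Δ) ≤ √(G m Δ Δ) * (C * arcLength G w a b) :=
    calc √(G m Δ Δ) * √(G m Δ Δ) = G m Δ Δ := Real.mul_self_sqrt (hG.apply_self_nonneg hm Δ)
      _ = ∫ t in a..b, G m Δ (derivWithin w (Icc a b) t) := by
          rw [(G m Δ).intervalIntegral_comp_comm (hw'.intervalIntegrable_of_Icc hab.le),
            intervalIntegral.integral_derivWithin_Icc_of_contDiffOn_Icc hw hab.le]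
      _ ≤ ∫ t in a..b, √(G m Δ Δ) *
            (C * √(G (w t) (derivWithin w (Icc a b) t) (derivWithin w (Icc a b) t))) :=
          intervalIntegral.integral_mono_on hab.le
            (((G m Δ).continuous.comp_continuousOn hw').intervalIntegrable_of_Icc hab.le)
            (((hspeed.intervalIntegrable_of_Icc hab.le).const_mul C).const_mul _) fun t ht =>
              (hG.apply_le_sqrt_mul_sqrt hm _ _).trans
                (mul_le_mul_of_nonneg_left (hG.sqrt_apply_derivWithin_le hab hw hwB hm ht)
                  (Real.sqrt_nonneg _))
      _ = √(G m Δ Δ) * (C * arcLength G w a b) := by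
          rw [intervalIntegral.integral_const_mul, intervalIntegral.integral_const_mul, arcLength]
  rcases (Real.sqrt_nonneg (G m Δ Δ)).eq_or_lt with h | h
  · rw [← h]
    have := hG.ellipticity_pos
    have := hG.distortion_nonneg
    positivity
  · exact le_of_mul_le_mul_left hsq h

end IsRiemannianOn

lemma isCoercive_of_forall_apply_self_pos [FiniteDimensional ℝ E] {A : E →L[ℝ] E →L[ℝ] ℝ}
    (hA : ∀ v ≠ 0, 0 < A v v) : IsCoercive A := by
  rcases (Metric.sphere (0 : E) 1).eq_empty_or_nonempty with h | h
  · have hzero : ∀ v : E, v = 0 := fun v => by_contra fun hv =>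
      h.subset (mem_sphere_zero_iff_norm.2 (norm_smul_inv_norm (𝕜 := ℝ) hv))
    exact ⟨1, one_pos, fun v => by simp [hzero v]⟩
  · have hcont : Continuous fun v : E => A v v := by fun_prop
    obtain ⟨v₀, hv₀, hmin⟩ := (isCompact_sphere (0 : E) 1).exists_isMinOn h hcont.continuousOn
    refine ⟨A v₀ v₀, hA v₀ (ne_zero_of_mem_unit_sphere ⟨v₀, hv₀⟩), fun v => ?_⟩
    rcases eq_or_ne v 0 with rfl | hv
    · simp
    have : 0 < ‖v‖ := norm_pos_iff.2 hv
    have hle : A v₀ v₀ ≤ A (‖v‖⁻¹ • v) (‖v‖⁻¹ • v) :=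
      hmin (mem_sphere_zero_iff_norm.2 (norm_smul_inv_norm (𝕜 := ℝ) hv))
    simp only [map_smul, _root_.smul_apply, smul_eq_mul] at hle
    calc A v₀ v₀ * ‖v‖ * ‖v‖ ≤ ‖v‖⁻¹ * (‖v‖⁻¹ * A v v) * ‖v‖ * ‖v‖ := by gcongr
      _ = A v v := by field_simp

lemma apply_self_le_add_norm_sub (A A' : E →L[ℝ] E →L[ℝ] ℝ) (v : E) :
    A v v ≤ A' v v + ‖A - A'‖ * ‖v‖ ^ 2 := by
  have h := (Real.le_norm_self _).trans ((A - A').le_opNorm₂ v v)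
  simp only [_root_.sub_apply] at h
  linarith [sq ‖v‖]

lemma sqrt_apply_self_le_of_le_apply_self {A A' : E →L[ℝ] E →L[ℝ] ℝ} {c : ℝ} (hc : 0 < c) {v : E}
    (hA' : c * ‖v‖ ^ 2 ≤ A' v v) : √(A v v) ≤ (1 + ‖A - A'‖ / c) * √(A' v v) := by
  set δ := ‖A - A'‖ / c with hδ_def
  have hδ : 0 ≤ δ := by positivity
  have hA'_nonneg : 0 ≤ A' v v := le_trans (by positivity) hA'
  refine Real.sqrt_le_iff.2 ⟨by positivity, ?_⟩
  calc A v v ≤ A' v v + ‖A - A'‖ * ‖v‖ ^ 2 := apply_self_le_add_norm_sub A A' v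
    _ = A' v v + δ * (c * ‖v‖ ^ 2) := by rw [hδ_def]; field_simp
    _ ≤ A' v v + δ * A' v v := by gcongr
    _ ≤ (1 + δ) ^ 2 * A' v v := by nlinarith [mul_nonneg hδ hA'_nonneg, mul_nonneg hδ hδ]
    _ = ((1 + δ) * √(A' v v)) ^ 2 := by rw [mul_pow, Real.sq_sqrt hA'_nonneg]

theorem exists_isRiemannianOn_ball [FiniteDimensional ℝ E] {U : Set E} (hU : IsOpen U)
    (hG : ContDiffOn ℝ ∞ G U) (hsymm : ∀ y ∈ U, ∀ v w, G y v w = G y w v) {x : E} (hx : x ∈ U)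
    (hpos : ∀ v, v ≠ 0 → 0 < G x v v) :
    ∃ ε κ K, 0 < ε ∧ Metric.ball x ε ⊆ U ∧ IsRiemannianOn G (Metric.ball x ε) κ K := by
  obtain ⟨c, hc, hcx⟩ := isCoercive_of_forall_apply_self_pos hpos
  have hat : ContDiffAt ℝ 1 G x :=
    (hG.contDiffAt (hU.mem_nhds hx)).of_le (by exact_mod_cast le_top)
  obtain ⟨L, t, ht, hL⟩ := hat.exists_lipschitzOnWith
  obtain ⟨ε, hε, hsub⟩ := Metric.mem_nhds_iff.1 (inter_mem (inter_mem ht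
    (hat.continuousAt (Metric.ball_mem_nhds (G x) (half_pos hc)))) (hU.mem_nhds hx))
  have helliptic : ∀ y ∈ Metric.ball x ε, ∀ v, c / 2 * ‖v‖ ^ 2 ≤ G y v v := by
    intro y hy v
    have hnear : ‖G x - G y‖ ≤ c / 2 := (mem_ball_iff_norm'.1 (hsub hy).1.2).le
    linarith [apply_self_le_add_norm_sub (G x) (G y) v, hcx v,
      mul_le_mul_of_nonneg_right hnear (sq_nonneg ‖v‖), sq ‖v‖]
  refine ⟨ε, √(c / 2), L / (c / 2), hε, fun y hy => (hsub hy).2, Metric.isOpen_ball,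
    convex_ball x ε, hG.mono fun y hy => (hsub hy).2, fun y hy => hsymm y (hsub hy).2,
    Real.sqrt_pos.2 (half_pos hc), fun y hy v => ?_, by positivity, fun y hy z hz v => ?_⟩
  · rw [← Real.sqrt_sq (norm_nonneg v), ← Real.sqrt_mul (half_pos hc).le]
    exact Real.sqrt_le_sqrt (helliptic y hy v)
  · refine (sqrt_apply_self_le_of_le_apply_self (half_pos hc) (helliptic z hz v)).trans ?_
    rw [div_mul_eq_mul_div]
    gcongr
    simpa only [dist_eq_norm] using hL.dist_le_mul y (hsub hy).1.1 z (hsub hz).1.1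

end LocalMetric

section ChartMetric

set_option maxSynthPendingDepth 3

variable {E : Type*} [NormedAddCommGroup E] [NormedSpace ℝ E]
  {S : Type*} [TopologicalSpace S] [ChartedSpace E S] [IsManifold 𝓘(ℝ, E) ∞ S]

/-- The Riemannian metric `k` read in the chart at `x`, as a field of bilinear forms on the model
space; only its values on the target of the chart are meaningful. -/
noncomputable def chartMetric
    (k : ContMDiffRiemannianMetric 𝓘(ℝ, E) ∞ E (fun p : S => TangentSpace 𝓘(ℝ, E) p))
    (x : S) (y : E) : E →L[ℝ] E →L[ℝ] ℝ :=
  let D : E →L[ℝ] TangentSpace 𝓘(ℝ, E) ((extChartAt 𝓘(ℝ, E) x).symm y) :=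
    mfderiv 𝓘(ℝ, E) 𝓘(ℝ, E) (extChartAt 𝓘(ℝ, E) x).symm y
  (ContinuousLinearMap.precomp ℝ D).comp ((k.inner ((extChartAt 𝓘(ℝ, E) x).symm y)).comp D)

variable (k : ContMDiffRiemannianMetric 𝓘(ℝ, E) ∞ E (fun p : S => TangentSpace 𝓘(ℝ, E) p))

lemma chartMetric_apply (x : S) (y v w : E) :
    chartMetric k x y v w = k.inner ((extChartAt 𝓘(ℝ, E) x).symm y)
      (mfderiv 𝓘(ℝ, E) 𝓘(ℝ, E) (extChartAt 𝓘(ℝ, E) x).symm y v)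
      (mfderiv 𝓘(ℝ, E) 𝓘(ℝ, E) (extChartAt 𝓘(ℝ, E) x).symm y w) := rfl

lemma chartMetric_pos (x : S) {y : E} (hy : y ∈ (extChartAt 𝓘(ℝ, E) x).target) {v : E}
    (hv : v ≠ 0) : 0 < chartMetric k x y v v := by
  have : IsManifold 𝓘(ℝ, E) 1 S := .of_le (n := ∞) (by exact_mod_cast le_top)
  obtain ⟨D, hD⟩ := isInvertible_mfderivWithin_extChartAt_symm (I := 𝓘(ℝ, E)) hy
  rw [ModelWithCorners.range_eq_univ, mfderivWithin_univ] at hD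
  rw [chartMetric_apply, ← hD]
  exact k.pos _ _ (D.map_ne_zero_iff.2 hv)

lemma contMDiffOn_mfderiv_extChartAt_symm (x : S) (v : E) :
    ContMDiffOn 𝓘(ℝ, E) (𝓘(ℝ, E).prod 𝓘(ℝ, E)) ∞
      (fun y : E => (⟨(extChartAt 𝓘(ℝ, E) x).symm y,
        mfderiv 𝓘(ℝ, E) 𝓘(ℝ, E) (extChartAt 𝓘(ℝ, E) x).symm y v⟩ : TangentBundle 𝓘(ℝ, E) S))
      (extChartAt 𝓘(ℝ, E) x).target := by
  have hopen : IsOpen (extChartAt 𝓘(ℝ, E) x).target := isOpen_extChartAt_target x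
  have htangentMap :=
    (contMDiffOn_extChartAt_symm (I := 𝓘(ℝ, E)) (n := ∞) x).contMDiffOn_tangentMapWithin
      (m := ∞) (by simp) hopen.uniqueMDiffOn
  have hconst : ContMDiff 𝓘(ℝ, E) (𝓘(ℝ, E).prod 𝓘(ℝ, E)) ∞
      (fun y : E => (⟨y, v⟩ : TangentBundle 𝓘(ℝ, E) E)) := fun y =>
    (Bundle.contMDiffAt_section (E := fun y : E => TangentSpace 𝓘(ℝ, E) y) y).2
      (by simpa using contMDiffAt_const)
  refine (htangentMap.comp hconst.contMDiffOn fun y hy => hy).congr fun y hy => ?_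
  simp only [Function.comp_apply, tangentMapWithin]
  rw [mfderivWithin_of_isOpen hopen hy]

lemma contDiffOn_chartMetric [FiniteDimensional ℝ E] (x : S) :
    ContDiffOn ℝ ∞ (chartMetric k x) (extChartAt 𝓘(ℝ, E) x).target := by
  refine contDiffOn_clm_apply.2 fun v => contDiffOn_clm_apply.2 fun w => ?_
  rw [← contMDiffOn_iff_contDiffOn]
  intro y hy
  have hsection : ContMDiffWithinAt 𝓘(ℝ, E) (𝓘(ℝ, E).prod 𝓘(ℝ)) ∞
      (fun y => TotalSpace.mk' ℝ (E := Bundle.Trivial S ℝ) ((extChartAt 𝓘(ℝ, E) x).symm y)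
        (chartMetric k x y v w)) (extChartAt 𝓘(ℝ, E) x).target y :=
    ContMDiffWithinAt.clm_bundle_apply₂ (𝕜 := ℝ) (F₁ := E) (F₂ := E) (F₃ := ℝ)
      (E₁ := fun p : S => TangentSpace 𝓘(ℝ, E) p) (E₂ := fun p : S => TangentSpace 𝓘(ℝ, E) p)
      (E₃ := Bundle.Trivial S ℝ)
      (v := fun y => mfderiv 𝓘(ℝ, E) 𝓘(ℝ, E) (extChartAt 𝓘(ℝ, E) x).symm y v)
      (w := fun y => mfderiv 𝓘(ℝ, E) 𝓘(ℝ, E) (extChartAt 𝓘(ℝ, E) x).symm y w)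
      (ψ := fun y => k.inner ((extChartAt 𝓘(ℝ, E) x).symm y))
      (k.contMDiff.contMDiffAt.comp_contMDiffWithinAt y (contMDiffOn_extChartAt_symm x y hy))
      (contMDiffOn_mfderiv_extChartAt_symm x v y hy) (contMDiffOn_mfderiv_extChartAt_symm x w y hy)
  simp only [contMDiffWithinAt_totalSpace] at hsection
  exact hsection.2

lemma mfderivWithin_extChartAt_symm_comp (x : S) {w : ℝ → E} {J : Set ℝ} {s : ℝ}
    (hw : DifferentiableWithinAt ℝ w J s) (hJ : UniqueDiffWithinAt ℝ J s)
    (hs : w s ∈ (extChartAt 𝓘(ℝ, E) x).target) :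
    mfderivWithin 𝓘(ℝ, ℝ) 𝓘(ℝ, E) ((extChartAt 𝓘(ℝ, E) x).symm ∘ w) J s 1 =
      mfderiv 𝓘(ℝ, E) 𝓘(ℝ, E) (extChartAt 𝓘(ℝ, E) x).symm (w s) (derivWithin w J s) := by
  have hsymm : MDifferentiableAt 𝓘(ℝ, E) 𝓘(ℝ, E) (extChartAt 𝓘(ℝ, E) x).symm (w s) :=
    ((contMDiffOn_extChartAt_symm (I := 𝓘(ℝ, E)) (n := ∞) x).contMDiffAt
      ((isOpen_extChartAt_target x).mem_nhds hs)).mdifferentiableAt (by simp)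
  rw [mfderiv_comp_mfderivWithin s hsymm hw.mdifferentiableWithinAt hJ.uniqueMDiffWithinAt,
    mfderivWithin_eq_fderivWithin]
  rfl

end ChartMetric

section MetricLength

open MeasureTheory Manifold

variable {E : Type*} [NormedAddCommGroup E] [NormedSpace ℝ E]
  {S : Type*} [TopologicalSpace S] [ChartedSpace E S] [IsManifold 𝓘(ℝ, E) ∞ S]
  (k : ContMDiffRiemannianMetric 𝓘(ℝ, E) ∞ E (fun p : S => TangentSpace 𝓘(ℝ, E) p))

/-- The `k`-norm of the velocity at `s` of a curve `γ : J → S`, one-sided at the endpoints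
of `J`. -/
noncomputable def metricSpeed (γ : ℝ → S) (J : Set ℝ) (s : ℝ) : ℝ :=
  √(k.inner (γ s) (mfderivWithin 𝓘(ℝ, ℝ) 𝓘(ℝ, E) γ J s 1)
    (mfderivWithin 𝓘(ℝ, ℝ) 𝓘(ℝ, E) γ J s 1))

/-- The `k`-length of a curve `γ : [a, b] → S`. It is Mathlib's `pathELength` for the norms that `k`
puts on the tangent spaces, with `k` as an argument instead of an instance. -/
noncomputable def metricLength (γ : ℝ → S) (a b : ℝ) : ENNReal :=
  ∫⁻ s in Icc a b, ENNReal.ofReal (metricSpeed k γ (Icc a b) s)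

lemma pathELength_eq_metricLength (γ : ℝ → S) (a b : ℝ) :
    letI : RiemannianBundle (fun p : S => TangentSpace 𝓘(ℝ, E) p) := ⟨k.toRiemannianMetric⟩
    pathELength 𝓘(ℝ, E) γ a b = metricLength k γ a b := by
  let : RiemannianBundle (fun p : S => TangentSpace 𝓘(ℝ, E) p) := ⟨k.toRiemannianMetric⟩
  rw [pathELength_eq_lintegral_mfderivWithin_Icc, metricLength]
  refine lintegral_congr fun s => ?_
  rw [← ofReal_norm, metricSpeed]
  exact congrArg ENNReal.ofReal (norm_eq_sqrt_real_inner
    (F := TangentSpace 𝓘(ℝ, E) (γ s)) (mfderivWithin 𝓘(ℝ, ℝ) 𝓘(ℝ, E) γ (Icc a b) s 1))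

variable {k}

lemma metricEDist_le_metricLength {γ : ℝ → S} {a b : ℝ} (hab : a ≤ b)
    (hγ : ContMDiffOn 𝓘(ℝ, ℝ) 𝓘(ℝ, E) 1 γ (Icc a b)) :
    metricEDist k (γ a) (γ b) ≤ metricLength k γ a b := by
  let : RiemannianBundle (fun p : S => TangentSpace 𝓘(ℝ, E) p) := ⟨k.toRiemannianMetric⟩
  rw [← pathELength_eq_metricLength]
  exact riemannianEDist_le_pathELength hγ rfl rfl hab

lemma metricLength_add {γ : ℝ → S} {a b c : ℝ} (hab : a ≤ b) (hbc : b ≤ c) :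
    metricLength k γ a b + metricLength k γ b c = metricLength k γ a c := by
  let : RiemannianBundle (fun p : S => TangentSpace 𝓘(ℝ, E) p) := ⟨k.toRiemannianMetric⟩
  simp only [← pathELength_eq_metricLength]
  exact pathELength_add hab hbc

lemma metricLength_congr {γ γ' : ℝ → S} {a b : ℝ} (h : EqOn γ γ' (Icc a b)) :
    metricLength k γ a b = metricLength k γ' a b := by
  let : RiemannianBundle (fun p : S => TangentSpace 𝓘(ℝ, E) p) := ⟨k.toRiemannianMetric⟩
  simp only [← pathELength_eq_metricLength]
  exact pathELength_congr h

lemma exists_metricLength_lt_of_metricEDist_lt {x y : S} {r : ENNReal}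
    (h : metricEDist k x y < r) :
    ∃ γ : ℝ → S, γ 0 = x ∧ γ 1 = y ∧ ContMDiffOn 𝓘(ℝ, ℝ) 𝓘(ℝ, E) 1 γ (Icc 0 1) ∧
      metricLength k γ 0 1 < r := by
  let : RiemannianBundle (fun p : S => TangentSpace 𝓘(ℝ, E) p) := ⟨k.toRiemannianMetric⟩
  simp only [← pathELength_eq_metricLength]
  exact exists_lt_of_riemannianEDist_lt h

lemma metricEDist_le_metricLength_of_mem {γ : ℝ → S} {a b t : ℝ} (ht : t ∈ Icc a b)
    (hγ : ContMDiffOn 𝓘(ℝ, ℝ) 𝓘(ℝ, E) 1 γ (Icc a b)) :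
    metricEDist k (γ a) (γ t) ≤ metricLength k γ a b := by
  rw [← metricLength_add ht.1 ht.2]
  exact (metricEDist_le_metricLength ht.1 (hγ.mono (Icc_subset_Icc_right ht.2))).trans le_self_add

variable (k)

/-- The distance of the Riemannian metric `k` as an extended metric structure on `S`. Its uniform
structure induces the given topology of `S`. -/
@[reducible] noncomputable def metricEMetricSpace [FiniteDimensional ℝ E] [T2Space S] :
    EMetricSpace S :=
  letI : RiemannianBundle (fun p : S => TangentSpace 𝓘(ℝ, E) p) := ⟨k.toRiemannianMetric⟩
  haveI : IsContinuousRiemannianBundle E (fun p : S => TangentSpace 𝓘(ℝ, E) p) :=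
    ⟨k.inner, k.contMDiff.continuous, fun _ _ _ => rfl⟩
  haveI : LocallyCompactSpace S := Manifold.locallyCompact_of_finiteDimensional 𝓘(ℝ, E)
  EMetricSpace.ofRiemannianMetric 𝓘(ℝ, E) S

lemma hasApproxIntermediatePoints_metricEMetricSpace [FiniteDimensional ℝ E] [T2Space S] :
    @HasApproxIntermediatePoints S (metricEMetricSpace k).toPseudoEMetricSpace := by
  let := metricEMetricSpace k
  intro x y r s _ hxy
  rcases le_or_gt (edist x y) r with h | h
  · exact ⟨y, h, by simp⟩
  obtain ⟨γ, rfl, rfl, hγ, hlength⟩ :=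
    exists_metricLength_lt_of_metricEDist_lt (show metricEDist k x y < r + s from hxy)
  have hcont : ContinuousOn (fun τ => edist (γ 0) (γ τ)) (Icc 0 1) :=
    (continuous_const.edist continuous_id).comp_continuousOn hγ.continuousOn
  obtain ⟨τ, hτ, hτr⟩ : r ∈ (fun τ => edist (γ 0) (γ τ)) '' Icc 0 1 :=
    intermediate_value_Icc zero_le_one hcont ⟨by simp, h.le⟩
  refine ⟨γ τ, hτr.le, ?_⟩
  rw [← metricLength_add hτ.1 hτ.2] at hlength
  have hinitial : r ≤ metricLength k γ 0 τ :=
    hτr.symm.trans_le (metricEDist_le_metricLength hτ.1 (hγ.mono (Icc_subset_Icc_right hτ.2)))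
  have hfinal : edist (γ τ) (γ 1) ≤ metricLength k γ τ 1 :=
    metricEDist_le_metricLength hτ.2 (hγ.mono (Icc_subset_Icc_left hτ.1))
  refine hfinal.trans ?_
  by_contra! hlt
  exact absurd hlength (not_lt.2 (add_le_add hinitial hlt.le))

end MetricLength

section ChartLength

set_option maxSynthPendingDepth 3

open MeasureTheory Manifold

variable {E : Type*} [NormedAddCommGroup E] [NormedSpace ℝ E]
  {S : Type*} [TopologicalSpace S] [ChartedSpace E S] [IsManifold 𝓘(ℝ, E) ∞ S]
  {k : ContMDiffRiemannianMetric 𝓘(ℝ, E) ∞ E (fun p : S => TangentSpace 𝓘(ℝ, E) p)}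

lemma metricSpeed_extChartAt_symm_comp (x : S) {w : ℝ → E} {J : Set ℝ} {s : ℝ}
    (hw : DifferentiableWithinAt ℝ w J s) (hJ : UniqueDiffWithinAt ℝ J s)
    (hs : w s ∈ (extChartAt 𝓘(ℝ, E) x).target) :
    metricSpeed k ((extChartAt 𝓘(ℝ, E) x).symm ∘ w) J s =
      √(chartMetric k x (w s) (derivWithin w J s) (derivWithin w J s)) := by
  rw [metricSpeed, mfderivWithin_extChartAt_symm_comp x hw hJ hs, chartMetric_apply]
  rfl

variable [FiniteDimensional ℝ E]

lemma metricLength_extChartAt_symm_comp (x : S) {w : ℝ → E} {a b : ℝ} (hab : a ≤ b)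
    (hw : ContDiffOn ℝ 1 w (Icc a b)) (hwx : MapsTo w (Icc a b) (extChartAt 𝓘(ℝ, E) x).target) :
    metricLength k ((extChartAt 𝓘(ℝ, E) x).symm ∘ w) a b =
      ENNReal.ofReal (arcLength (chartMetric k x) w a b) := by
  rcases hab.eq_or_lt with rfl | hlt
  · simp [metricLength, arcLength]
  have hspeed := (continuousOn_apply_derivWithin (contDiffOn_chartMetric k x).continuousOn
    hlt hw hwx).sqrt
  rw [metricLength, arcLength, intervalIntegral.integral_of_le hab,
    ← integral_Icc_eq_integral_Ioc,
    ofReal_integral_eq_lintegral_ofReal (hspeed.integrableOn_compact isCompact_Icc)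
      (Eventually.of_forall fun t => Real.sqrt_nonneg _)]
  refine setLIntegral_congr_fun measurableSet_Icc fun t ht => ?_
  rw [metricSpeed_extChartAt_symm_comp x (hw.differentiableOn one_ne_zero t ht)
    (uniqueDiffOn_Icc hlt t ht) (hwx ht)]

lemma metricEDist_extChartAt_symm_le_arcLength (x : S) {w : ℝ → E} {a b : ℝ} (hab : a ≤ b)
    (hw : ContDiffOn ℝ 1 w (Icc a b)) (hwx : MapsTo w (Icc a b) (extChartAt 𝓘(ℝ, E) x).target) :
    metricEDist k ((extChartAt 𝓘(ℝ, E) x).symm (w a)) ((extChartAt 𝓘(ℝ, E) x).symm (w b)) ≤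
      ENNReal.ofReal (arcLength (chartMetric k x) w a b) := by
  rw [← metricLength_extChartAt_symm_comp x hab hw hwx]
  exact metricEDist_le_metricLength (γ := (extChartAt 𝓘(ℝ, E) x).symm ∘ w) hab
    ((contMDiffOn_extChartAt_symm (n := 1) x).comp hw.contMDiffOn hwx)

lemma exists_arcLength_lt_of_metricEDist_lt (x : S) {U : Set E} {y z : S} {ℓ : ℝ}
    (hyz : metricEDist k y z < ENNReal.ofReal ℓ)
    (hU : ∀ q, metricEDist k y q < ENNReal.ofReal ℓ →
      q ∈ (extChartAt 𝓘(ℝ, E) x).source ∧ extChartAt 𝓘(ℝ, E) x q ∈ U) :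
    ∃ w : ℝ → E, w 0 = extChartAt 𝓘(ℝ, E) x y ∧ w 1 = extChartAt 𝓘(ℝ, E) x z ∧
      ContDiffOn ℝ 1 w (Icc 0 1) ∧ MapsTo w (Icc 0 1) U ∧
      arcLength (chartMetric k x) w 0 1 < ℓ := by
  obtain ⟨γ, rfl, rfl, hγ, hlength⟩ := exists_metricLength_lt_of_metricEDist_lt hyz
  have hγU : ∀ t ∈ Icc (0 : ℝ) 1, γ t ∈ (extChartAt 𝓘(ℝ, E) x).source ∧
      extChartAt 𝓘(ℝ, E) x (γ t) ∈ U := fun t ht =>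
    hU _ ((metricEDist_le_metricLength_of_mem ht hγ).trans_lt hlength)
  have hw : ContDiffOn ℝ 1 (extChartAt 𝓘(ℝ, E) x ∘ γ) (Icc 0 1) := by
    rw [← contMDiffOn_iff_contDiffOn]
    refine (contMDiffOn_extChartAt (I := 𝓘(ℝ, E)) (n := 1) (x := x)).comp hγ fun t ht => ?_
    rw [mem_preimage, ← extChartAt_source 𝓘(ℝ, E) x]
    exact (hγU t ht).1
  refine ⟨extChartAt 𝓘(ℝ, E) x ∘ γ, rfl, rfl, hw, fun t ht => (hγU t ht).2, ?_⟩
  have hsymm : EqOn ((extChartAt 𝓘(ℝ, E) x).symm ∘ extChartAt 𝓘(ℝ, E) x ∘ γ) γ (Icc 0 1) :=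
    fun t ht => (extChartAt 𝓘(ℝ, E) x).left_inv (hγU t ht).1
  rw [← metricLength_congr hsymm, metricLength_extChartAt_symm_comp x zero_le_one hw
    fun t ht => (extChartAt 𝓘(ℝ, E) x).map_source (hγU t ht).1] at hlength
  exact (ENNReal.ofReal_lt_ofReal_iff_of_nonneg (arcLength_nonneg _ _ zero_le_one)).1 hlength

end ChartLength

section Geodesics

set_option maxSynthPendingDepth 3

open Manifold

variable {E : Type*} [NormedAddCommGroup E] [NormedSpace ℝ E]
  {S : Type*} [TopologicalSpace S] [ChartedSpace E S] [IsManifold 𝓘(ℝ, E) ∞ S]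
  {k : ContMDiffRiemannianMetric 𝓘(ℝ, E) ∞ E (fun p : S => TangentSpace 𝓘(ℝ, E) p)}

lemma metricEDist_self (x : S) : metricEDist k x x = 0 := by
  let : RiemannianBundle (fun p : S => TangentSpace 𝓘(ℝ, E) p) := ⟨k.toRiemannianMetric⟩
  exact riemannianEDist_self

lemma metricEDist_comm (x y : S) : metricEDist k x y = metricEDist k y x := by
  let : RiemannianBundle (fun p : S => TangentSpace 𝓘(ℝ, E) p) := ⟨k.toRiemannianMetric⟩
  exact riemannianEDist_comm

lemma metricEDist_triangle (x y z : S) :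
    metricEDist k x z ≤ metricEDist k x y + metricEDist k y z := by
  let : RiemannianBundle (fun p : S => TangentSpace 𝓘(ℝ, E) p) := ⟨k.toRiemannianMetric⟩
  exact riemannianEDist_triangle

lemma metricSpeed_congr {γ γ' : ℝ → S} {J : Set ℝ} (h : EqOn γ γ' J) {s : ℝ} (hs : s ∈ J) :
    metricSpeed k γ J s = metricSpeed k γ' J s := by
  have hvelocity : (mfderivWithin 𝓘(ℝ, ℝ) 𝓘(ℝ, E) γ J s : ℝ →L[ℝ] E) =
      mfderivWithin 𝓘(ℝ, ℝ) 𝓘(ℝ, E) γ' J s := mfderivWithin_congr h (h hs)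
  exact congrArg₂ (fun (p : S) (v : ℝ →L[ℝ] E) => √(k.inner p (v 1 : E) (v 1 : E))) (h hs)
    hvelocity

lemma metricSpeed_congr_set {γ : ℝ → S} {J J' : Set ℝ} {s : ℝ} (h : J =ᶠ[𝓝 s] J') :
    metricSpeed k γ J s = metricSpeed k γ J' s := by
  rw [metricSpeed, metricSpeed, mfderivWithin_congr_set h]

variable [FiniteDimensional ℝ E]

lemma exists_metricEDist_lt_subset_of_mem_nhds [T2Space S]
    (k : ContMDiffRiemannianMetric 𝓘(ℝ, E) ∞ E (fun p : S => TangentSpace 𝓘(ℝ, E) p))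
    {x : S} {U : Set S} (hU : U ∈ 𝓝 x) :
    ∃ ρ : ℝ, 0 < ρ ∧ ∀ q, metricEDist k x q < ENNReal.ofReal ρ → q ∈ U := by
  let := metricEMetricSpace k
  obtain ⟨r, hr, hball⟩ := Metric.nhds_basis_eball.mem_iff.1 hU
  obtain ⟨ρ, -, hρr⟩ := ENNReal.lt_iff_exists_real_btwn.1 hr
  refine ⟨ρ, by simpa using hρr.1, fun q hq => hball ?_⟩
  rw [Metric.mem_eball, edist_comm]
  exact lt_trans hq hρr.2

lemma chord_le_of_metricEDist_le (x : S) {B : Set E} {κ K : ℝ}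
    (hG : IsRiemannianOn (chartMetric k x) B κ K) {y z : S} {ℓ ρ : ℝ} (hℓ : 0 ≤ ℓ) (hρ : 0 < ρ)
    (hyz : metricEDist k y z ≤ ENNReal.ofReal ℓ)
    (hyB : ∀ q, metricEDist k y q < ENNReal.ofReal (ℓ + ρ) →
      q ∈ (extChartAt 𝓘(ℝ, E) x).source ∧ extChartAt 𝓘(ℝ, E) x q ∈ B) {m : E} (hm : m ∈ B) :
    √(chartMetric k x m (extChartAt 𝓘(ℝ, E) x z - extChartAt 𝓘(ℝ, E) x y)
      (extChartAt 𝓘(ℝ, E) x z - extChartAt 𝓘(ℝ, E) x y)) ≤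
      (1 + K * (‖m - extChartAt 𝓘(ℝ, E) x y‖ + ℓ / κ)) * ℓ := by
  set φ := extChartAt 𝓘(ℝ, E) x
  have hκ := hG.ellipticity_pos
  have hK := hG.distortion_nonneg
  have approx : ∀ᶠ r in 𝓝[>] (0 : ℝ), √(chartMetric k x m (φ z - φ y) (φ z - φ y)) ≤
      (1 + K * (‖m - φ y‖ + (ℓ + r) / κ)) * (ℓ + r) := by
    filter_upwards [Ioo_mem_nhdsGT hρ] with r hr
    have hpos : 0 < ℓ + r := by linarith [hr.1]
    obtain ⟨w, hw0, hw1, hw, hwB, hlt⟩ := exists_arcLength_lt_of_metricEDist_lt x (U := B)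
      (hyz.trans_lt ((ENNReal.ofReal_lt_ofReal_iff hpos).2 (by linarith [hr.1])))
      fun q hq => hyB q (hq.trans_le (ENNReal.ofReal_le_ofReal (by linarith [hr.2])))
    have hchord := hG.chord_le_arcLength zero_lt_one hw hwB hm
    rw [hw0, hw1] at hchord
    have hlength := arcLength_nonneg (chartMetric k x) w zero_le_one
    exact hchord.trans (by gcongr)
  have hlim : Tendsto (fun r : ℝ => (1 + K * (‖m - φ y‖ + (ℓ + r) / κ)) * (ℓ + r))
      (𝓝[>] 0) (𝓝 ((1 + K * (‖m - φ y‖ + (ℓ + 0) / κ)) * (ℓ + 0))) :=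
    (Continuous.tendsto (by fun_prop) 0).mono_left nhdsWithin_le_nhds
  simpa only [add_zero] using ge_of_tendsto hlim approx

lemma isMinimizingOn_extChartAt_comp (x : S) {B : Set E} {κ K : ℝ}
    (hG : IsRiemannianOn (chartMetric k x) B κ K) (hB : B ⊆ (extChartAt 𝓘(ℝ, E) x).target)
    {c : ℝ → S} {a b ρ : ℝ} (hρ : 0 < ρ)
    (hc : ∀ s ∈ Icc a b, ∀ t ∈ Icc a b, metricEDist k (c s) (c t) = edist s t)
    (hcB : ∀ s ∈ Icc a b, ∀ q, metricEDist k (c s) q < ENNReal.ofReal (b - a + ρ) →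
      q ∈ (extChartAt 𝓘(ℝ, E) x).source ∧ extChartAt 𝓘(ℝ, E) x q ∈ B) :
    IsMinimizingOn (chartMetric k x) B (K * (1 + 1 / κ)) (extChartAt 𝓘(ℝ, E) x ∘ c) a b := by
  have hκ := hG.ellipticity_pos
  have hK := hG.distortion_nonneg
  have hmem : ∀ s ∈ Icc a b,
      c s ∈ (extChartAt 𝓘(ℝ, E) x).source ∧ extChartAt 𝓘(ℝ, E) x (c s) ∈ B := fun s hs =>
    hcB s hs _ (by
      rw [hc s hs s hs, edist_self, ENNReal.ofReal_pos]
      linarith [hs.1, hs.2])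
  refine ⟨fun s hs => (hmem s hs).2, fun s hs t ht hst α β w hαβ hw hwB hwα hwβ => ?_,
    fun s hs t ht hst m hm => ?_⟩
  · have hle := metricEDist_extChartAt_symm_le_arcLength (k := k) x hαβ hw (hwB.mono_right hB)
    rw [hwα, hwβ, Function.comp_apply, Function.comp_apply,
      (extChartAt 𝓘(ℝ, E) x).left_inv (hmem s hs).1,
      (extChartAt 𝓘(ℝ, E) x).left_inv (hmem t ht).1, hc s hs t ht, edist_eq_ofReal_sub hst] at hle
    exact (ENNReal.ofReal_le_ofReal_iff (arcLength_nonneg _ _ hαβ)).1 hle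
  · have h_nonneg : 0 ≤ t - s := sub_nonneg.2 hst
    refine (chord_le_of_metricEDist_le x hG h_nonneg hρ
      (by rw [hc s hs t ht, edist_eq_ofReal_sub hst]) (fun q hq => hcB s hs q (hq.trans_le
        (ENNReal.ofReal_le_ofReal (by linarith [hs.1, ht.2])))) hm).trans ?_
    rw [mul_assoc K, Function.comp_apply]
    gcongr
    have : 0 ≤ 1 / κ * ‖m - extChartAt 𝓘(ℝ, E) x (c s)‖ := by positivity
    rw [div_eq_mul_one_div, mul_comm (t - s)]
    linarith

lemma contMDiffOn_of_isMinimizingOn_extChartAt_comp (x : S) {B : Set E} {κ K : ℝ}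
    (hG : IsRiemannianOn (chartMetric k x) B κ K) {c : ℝ → S} {a b β : ℝ}
    (hsource : MapsTo c (Icc a b) (extChartAt 𝓘(ℝ, E) x).source)
    (hmin : IsMinimizingOn (chartMetric k x) B K (extChartAt 𝓘(ℝ, E) x ∘ c) a b)
    (ha : a < β) (hb : β < b) :
    ContMDiffOn 𝓘(ℝ, ℝ) 𝓘(ℝ, E) ∞ c (Icc a β) ∧ ∀ s ∈ Icc a β, metricSpeed k c (Icc a β) s ≤ 1 := by
  set φ := extChartAt 𝓘(ℝ, E) x
  have hsub : Icc a β ⊆ Icc a b := Icc_subset_Icc_right hb.le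
  have hsmooth : ContDiffOn ℝ ∞ (φ ∘ c) (Icc a β) := hmin.contDiffOn hG ha hb
  have hsymm : EqOn (φ.symm ∘ φ ∘ c) c (Icc a β) := fun s hs => φ.left_inv (hsource (hsub hs))
  have htarget : MapsTo (φ ∘ c) (Icc a β) φ.target := fun s hs => φ.map_source (hsource (hsub hs))
  refine ⟨((contMDiffOn_extChartAt_symm x).comp hsmooth.contMDiffOn htarget).congr hsymm.symm,
    fun s hs => ?_⟩
  rw [← metricSpeed_congr hsymm hs, metricSpeed_extChartAt_symm_comp x
    (hsmooth.differentiableOn (by simp) s hs) (uniqueDiffOn_Icc ha s hs) (htarget hs)]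
  exact Real.sqrt_le_one.2
    ((hmin.mono hsub).speed_le hG ha (hsmooth.differentiableOn (by simp)) hs)

lemma exists_isMinimizingOn_extChartAt_comp [T2Space S]
    (k : ContMDiffRiemannianMetric 𝓘(ℝ, E) ∞ E (fun p : S => TangentSpace 𝓘(ℝ, E) p)) (x : S) :
    ∃ ρ > 0, ∃ B κ K, IsRiemannianOn (chartMetric k x) B κ K ∧ ∀ (c : ℝ → S) (a b : ℝ),
      (∀ s ∈ Icc a b, ∀ t ∈ Icc a b, metricEDist k (c s) (c t) = edist s t) →
      2 * (b - a) < ρ → x ∈ c '' Icc a b →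
      MapsTo c (Icc a b) (extChartAt 𝓘(ℝ, E) x).source ∧
        IsMinimizingOn (chartMetric k x) B K (extChartAt 𝓘(ℝ, E) x ∘ c) a b := by
  obtain ⟨ε, κ, K, hε, hsub, hG⟩ := exists_isRiemannianOn_ball (isOpen_extChartAt_target x)
    (contDiffOn_chartMetric k x) (fun y _ v w => k.symm _ _ _) (mem_extChartAt_target x)
    fun v => chartMetric_pos k x (mem_extChartAt_target x)
  obtain ⟨ρ, hρ, hρB⟩ := exists_metricEDist_lt_subset_of_mem_nhds k <|
    inter_mem (extChartAt_source_mem_nhds (I := 𝓘(ℝ, E)) x)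
      ((continuousAt_extChartAt (I := 𝓘(ℝ, E)) x).preimage_mem_nhds (Metric.ball_mem_nhds _ hε))
  have hK : K ≤ K * (1 + 1 / κ) := le_mul_of_one_le_right hG.distortion_nonneg
    (le_add_of_nonneg_right (one_div_pos.2 hG.ellipticity_pos).le)
  refine ⟨ρ, hρ, Metric.ball (extChartAt 𝓘(ℝ, E) x x) ε, κ, K * (1 + 1 / κ),
    hG.mono_distortion hK, ?_⟩
  rintro c a b hc hab ⟨s₀, hs₀, rfl⟩
  have hnear : ∀ s ∈ Icc a b, ∀ q,
      metricEDist k (c s) q < ENNReal.ofReal (b - a + (ρ - 2 * (b - a))) →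
      metricEDist k (c s₀) q < ENNReal.ofReal ρ := by
    intro s hs q hq
    have hs₀s : metricEDist k (c s₀) (c s) ≤ ENNReal.ofReal (b - a) := by
      rw [hc s₀ hs₀ s hs, edist_dist]
      exact ENNReal.ofReal_le_ofReal (Real.dist_le_of_mem_Icc hs₀ hs)
    have hadd : ENNReal.ofReal (b - a) + ENNReal.ofReal (b - a + (ρ - 2 * (b - a))) =
        ENNReal.ofReal ρ := by
      rw [← ENNReal.ofReal_add (by linarith [hs₀.1, hs₀.2]) (by linarith [hs₀.1, hs₀.2])]
      ring_nf
    rw [← hadd]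
    exact (metricEDist_triangle _ (c s) q).trans_lt
      (ENNReal.add_lt_add_of_le_of_lt (ne_top_of_le_ne_top ENNReal.ofReal_ne_top hs₀s) hs₀s hq)
  refine ⟨fun s hs => (hρB _ (hnear s hs _ ?_)).1, isMinimizingOn_extChartAt_comp _ hG hsub
    (sub_pos.2 hab) hc fun s hs q hq => hρB q (hnear s hs q hq)⟩
  rw [hc s hs s hs, edist_self, ENNReal.ofReal_pos]
  linarith [hs.1, hs.2]

theorem contMDiffOn_of_metricEDist_eq [T2Space S] {c : ℝ → S} {R : ℝ}
    (hc : ∀ s ∈ Ico 0 R, ∀ t ∈ Ico 0 R, metricEDist k (c s) (c t) = edist s t) :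
    ContMDiffOn 𝓘(ℝ, ℝ) 𝓘(ℝ, E) ∞ c (Ico 0 R) ∧
      ∀ s ∈ Ico 0 R, metricSpeed k c (Ico 0 R) s ≤ 1 := by
  rw [ContMDiffOn, ← forall₂_and]
  intro s₀ hs₀
  obtain ⟨ρ, hρ, B, κ, K, hG, hmin⟩ := exists_isMinimizingOn_extChartAt_comp k (c s₀)
  obtain ⟨δ, hδ, hδ_lt⟩ := exists_between (lt_min (div_pos hρ (by norm_num : (0 : ℝ) < 6))
    (half_pos (sub_pos.2 hs₀.2)))
  obtain ⟨hδρ, hδR⟩ := lt_min_iff.1 hδ_lt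
  set a := max 0 (s₀ - δ)
  have ha : s₀ - δ ≤ a := le_max_right _ _
  have has₀ : a ≤ s₀ := max_le hs₀.1 (by linarith)
  have hsub : Icc a (s₀ + 2 * δ) ⊆ Ico 0 R := fun s hs =>
    ⟨(le_max_left _ _).trans hs.1, by linarith [hs.2]⟩
  obtain ⟨hsource, hmin⟩ := hmin c a (s₀ + 2 * δ)
    (fun s hs t ht => hc s (hsub hs) t (hsub ht)) (by linarith)
    (mem_image_of_mem c ⟨has₀, by linarith⟩)
  obtain ⟨hsmooth, hspeed⟩ := contMDiffOn_of_isMinimizingOn_extChartAt_comp (c s₀) hG hsource hmin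
    (show a < s₀ + δ by linarith) (by linarith)
  have hset : (Icc a (s₀ + δ) : Set ℝ) =ᶠ[𝓝 s₀] Ico 0 R := by
    filter_upwards [Ioo_mem_nhds (show s₀ - δ < s₀ by linarith) (show s₀ < s₀ + δ by linarith)]
      with s hs
    exact propext ⟨fun h => hsub (Icc_subset_Icc_right (by linarith) h),
      fun h => ⟨max_le h.1 hs.1.le, hs.2.le⟩⟩
  have hs₀' : s₀ ∈ Icc a (s₀ + δ) := ⟨has₀, by linarith⟩
  exact ⟨(hsmooth s₀ hs₀').congr_set hset,
    (metricSpeed_congr_set hset).symm.trans_le (hspeed s₀ hs₀')⟩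

end Geodesics

section StaticCausality

open MeasureTheory

lemma uniqueDiffOn_of_ordConnected {J : Set ℝ} (hJ : J.OrdConnected) (hn : J.Nontrivial) :
    UniqueDiffOn ℝ J :=
  uniqueDiffOn_convex hJ.convex (hJ.convex.nontrivial_iff_nonempty_interior.1 hn)

variable {E : Type*} [NormedAddCommGroup E] [NormedSpace ℝ E]
  {S : Type*} [TopologicalSpace S] [ChartedSpace E S]

lemma mfderiv_fst_timeVectorField (x : ℝ × S) :
    mfderiv (𝓘(ℝ, ℝ).prod 𝓘(ℝ, E)) 𝓘(ℝ, ℝ) (Prod.fst : ℝ × S → ℝ) x (timeVectorField x) =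
      (1 : ℝ) := by
  rw [timeVectorField, mfderiv_fst, mfderiv_prod_left]
  rfl

lemma mfderiv_snd_timeVectorField (x : ℝ × S) :
    mfderiv (𝓘(ℝ, ℝ).prod 𝓘(ℝ, E)) 𝓘(ℝ, E) (Prod.snd : ℝ × S → S) x (timeVectorField x) =
      (0 : E) := by
  rw [timeVectorField, mfderiv_snd, mfderiv_prod_left]
  rfl

lemma mfderiv_fst_mfderivWithin {γ : ℝ → ℝ × S} {J : Set ℝ} {s : ℝ}
    (hγ : MDifferentiableWithinAt 𝓘(ℝ, ℝ) (𝓘(ℝ, ℝ).prod 𝓘(ℝ, E)) γ J s)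
    (hJ : UniqueDiffWithinAt ℝ J s) :
    mfderiv (𝓘(ℝ, ℝ).prod 𝓘(ℝ, E)) 𝓘(ℝ, ℝ) (Prod.fst : ℝ × S → ℝ) (γ s)
      (mfderivWithin 𝓘(ℝ, ℝ) (𝓘(ℝ, ℝ).prod 𝓘(ℝ, E)) γ J s 1) =
    derivWithin (fun s => (γ s).1) J s := by
  rw [← fderivWithin_derivWithin, ← mfderivWithin_eq_fderivWithin]
  exact (congrArg (fun L : ℝ →L[ℝ] ℝ => L 1) (mfderiv_comp_mfderivWithin s
    (mdifferentiableAt_fst (x := γ s)) hγ hJ.uniqueMDiffWithinAt)).symm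

lemma mfderiv_snd_mfderivWithin {γ : ℝ → ℝ × S} {J : Set ℝ} {s : ℝ}
    (hγ : MDifferentiableWithinAt 𝓘(ℝ, ℝ) (𝓘(ℝ, ℝ).prod 𝓘(ℝ, E)) γ J s)
    (hJ : UniqueDiffWithinAt ℝ J s) :
    mfderiv (𝓘(ℝ, ℝ).prod 𝓘(ℝ, E)) 𝓘(ℝ, E) (Prod.snd : ℝ × S → S) (γ s)
      (mfderivWithin 𝓘(ℝ, ℝ) (𝓘(ℝ, ℝ).prod 𝓘(ℝ, E)) γ J s 1) =
    mfderivWithin 𝓘(ℝ, ℝ) 𝓘(ℝ, E) (fun s => (γ s).2) J s 1 :=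
  (congrArg (fun L : ℝ →L[ℝ] E => L 1) (mfderiv_comp_mfderivWithin s
    (mdifferentiableAt_snd (x := γ s)) hγ hJ.uniqueMDiffWithinAt)).symm

variable [IsManifold 𝓘(ℝ, E) ∞ S]
  {k : ContMDiffRiemannianMetric 𝓘(ℝ, E) ∞ E (fun p : S => TangentSpace 𝓘(ℝ, E) p)}

lemma metricSpeed_const (p : S) (J : Set ℝ) (s : ℝ) : metricSpeed k (fun _ => p) J s = 0 := by
  rw [metricSpeed, mfderivWithin_const]
  simp

lemma metricSpeed_subset {c : ℝ → S} {J J' : Set ℝ} {s : ℝ} (h : J' ⊆ J)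
    (hc : MDifferentiableWithinAt 𝓘(ℝ, ℝ) 𝓘(ℝ, E) c J s) (hJ' : UniqueDiffWithinAt ℝ J' s) :
    metricSpeed k c J' s = metricSpeed k c J s := by
  rw [metricSpeed, metricSpeed, mfderivWithin_subset h hJ'.uniqueMDiffWithinAt hc]

lemma metricSpeed_comp_neg {c : ℝ → S} {J : Set ℝ} {s : ℝ}
    (hc : MDifferentiableWithinAt 𝓘(ℝ, ℝ) 𝓘(ℝ, E) c J (-s)) (hJ : UniqueDiffWithinAt ℝ (-J) s) :
    metricSpeed k (fun s => c (-s)) (-J) s = metricSpeed k c J (-s) := by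
  have hneg : HasMFDerivWithinAt 𝓘(ℝ, ℝ) 𝓘(ℝ, ℝ) (fun s : ℝ => -s) (-J) s
      (-ContinuousLinearMap.id ℝ ℝ) :=
    ((hasFDerivAt_id s).neg.hasFDerivWithinAt).hasMFDerivWithinAt
  have hchain := (HasMFDerivWithinAt.comp s hc.hasMFDerivWithinAt hneg
    (fun r hr => by simpa using hr)).mfderivWithin hJ.uniqueMDiffWithinAt
  have hvelocity : (mfderivWithin 𝓘(ℝ, ℝ) 𝓘(ℝ, E) (fun s => c (-s)) (-J) s 1 : E) =
      -(mfderivWithin 𝓘(ℝ, ℝ) 𝓘(ℝ, E) c J (-s) 1 : E) :=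
    (congrArg (fun L : ℝ →L[ℝ] E => L 1) hchain).trans
      (map_neg (mfderivWithin 𝓘(ℝ, ℝ) 𝓘(ℝ, E) c J (-s) : ℝ →L[ℝ] E) (1 : ℝ))
  have heven : ∀ (p : S) (v : TangentSpace 𝓘(ℝ, E) p), k.inner p (-v) (-v) = k.inner p v v := by
    simp
  exact congrArg Real.sqrt ((congrArg (fun v : E => k.inner (c (-s)) v v) hvelocity).trans
    (heven _ _))

lemma metricEDist_le_of_metricSpeed_le_derivWithin {c : ℝ → S} {τ : ℝ → ℝ} {a b : ℝ} (hab : a < b)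
    (hc : ContMDiffOn 𝓘(ℝ, ℝ) 𝓘(ℝ, E) 1 c (Icc a b)) (hτ : ContDiffOn ℝ 1 τ (Icc a b))
    (h : ∀ s ∈ Icc a b, metricSpeed k c (Icc a b) s ≤ derivWithin τ (Icc a b) s) :
    metricEDist k (c a) (c b) ≤ ENNReal.ofReal (τ b - τ a) := by
  have hderiv := hτ.continuousOn_derivWithin (uniqueDiffOn_Icc hab) le_rfl
  calc metricEDist k (c a) (c b) ≤ metricLength k c a b := metricEDist_le_metricLength hab.le hc
    _ ≤ ∫⁻ s in Icc a b, ENNReal.ofReal (derivWithin τ (Icc a b) s) :=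
      setLIntegral_mono_ae' measurableSet_Icc
        (Eventually.of_forall fun s hs => ENNReal.ofReal_le_ofReal (h s hs))
    _ = ENNReal.ofReal (∫ s in a..b, derivWithin τ (Icc a b) s) := by
      rw [intervalIntegral.integral_of_le hab.le, ← integral_Icc_eq_integral_Ioc,
        ofReal_integral_eq_lintegral_ofReal (hderiv.integrableOn_compact isCompact_Icc)]
      filter_upwards [ae_restrict_mem measurableSet_Icc] with s hs
      exact (Real.sqrt_nonneg _).trans (h s hs)
    _ = ENNReal.ofReal (τ b - τ a) := by
      rw [intervalIntegral.integral_derivWithin_Icc_of_contDiffOn_Icc hτ hab.le]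

variable {h : ContMDiffRiemannianMetric 𝓘(ℝ, E) ∞ E (fun p : S => TangentSpace 𝓘(ℝ, E) p)}
  {V : S → ℝ} (hV : ContMDiff 𝓘(ℝ, E) 𝓘(ℝ, ℝ) ∞ V) (hpos : ∀ p, 0 < V p)

lemma staticMetric_apply {x : ℝ × S} {v w : TangentSpace (𝓘(ℝ, ℝ).prod 𝓘(ℝ, E)) x} {a b : ℝ}
    {v' w' : TangentSpace 𝓘(ℝ, E) x.2}
    (ha : mfderiv (𝓘(ℝ, ℝ).prod 𝓘(ℝ, E)) 𝓘(ℝ, ℝ) (Prod.fst : ℝ × S → ℝ) x v = a)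
    (hb : mfderiv (𝓘(ℝ, ℝ).prod 𝓘(ℝ, E)) 𝓘(ℝ, ℝ) (Prod.fst : ℝ × S → ℝ) x w = b)
    (hv : mfderiv (𝓘(ℝ, ℝ).prod 𝓘(ℝ, E)) 𝓘(ℝ, E) (Prod.snd : ℝ × S → S) x v = v')
    (hw : mfderiv (𝓘(ℝ, ℝ).prod 𝓘(ℝ, E)) 𝓘(ℝ, E) (Prod.snd : ℝ × S → S) x w = w') :
    staticMetric h V x v w = V x.2 ^ 2 * (a * b) - h.inner x.2 v' w' := by
  subst ha hb hv hw
  rfl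

lemma isCausalVector_and_future_iff {x : ℝ × S} {v : TangentSpace (𝓘(ℝ, ℝ).prod 𝓘(ℝ, E)) x}
    {a : ℝ} {w : TangentSpace 𝓘(ℝ, E) x.2}
    (ha : mfderiv (𝓘(ℝ, ℝ).prod 𝓘(ℝ, E)) 𝓘(ℝ, ℝ) (Prod.fst : ℝ × S → ℝ) x v = a)
    (hw : mfderiv (𝓘(ℝ, ℝ).prod 𝓘(ℝ, E)) 𝓘(ℝ, E) (Prod.snd : ℝ × S → S) x v = w) :
    IsCausalVector (𝓘(ℝ, ℝ).prod 𝓘(ℝ, E)) (staticMetric h V) v ∧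
      0 < staticMetric h V x v (timeVectorField x) ↔
    0 < a ∧ √((conformalMetric h V hV hpos).inner x.2 w w) ≤ a := by
  have hVx : 0 < V x.2 ^ 2 := pow_pos (hpos x.2) 2
  have htime : staticMetric h V x v (timeVectorField x) = V x.2 ^ 2 * a := by
    rw [staticMetric_apply (w' := 0) ha (mfderiv_fst_timeVectorField x) hw
      (mfderiv_snd_timeVectorField x), map_zero, mul_one, sub_zero]
  have hself : staticMetric h V x v v =
      V x.2 ^ 2 * (a ^ 2 - (conformalMetric h V hV hpos).inner x.2 w w) := by
    rw [staticMetric_apply ha ha hw hw, conformalMetric, _root_.smul_apply, _root_.smul_apply,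
      smul_eq_mul, mul_sub, mul_inv_cancel_left₀ hVx.ne', sq a]
  rw [IsCausalVector, htime, hself, mul_pos_iff_of_pos_left hVx, mul_nonneg_iff_of_pos_left hVx,
    sub_nonneg, Real.sqrt_le_iff]
  refine ⟨fun ⟨⟨_, hle⟩, hlt⟩ => ⟨hlt, hlt.le, hle⟩, fun ⟨hlt, _, hle⟩ => ⟨⟨?_, hle⟩, hlt⟩⟩
  rintro rfl
  rw [map_zero] at ha
  exact hlt.ne ha

lemma isFutureCausalCurve_staticMetric_iff {γ : ℝ → ℝ × S} {J : Set ℝ} :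
    IsFutureCausalCurve (𝓘(ℝ, ℝ).prod 𝓘(ℝ, E)) (staticMetric h V) timeVectorField γ J ↔
      J.OrdConnected ∧ J.Nontrivial ∧ ContDiffOn ℝ ∞ (fun s => (γ s).1) J ∧
      ContMDiffOn 𝓘(ℝ, ℝ) 𝓘(ℝ, E) ∞ (fun s => (γ s).2) J ∧
      ∀ s ∈ J, 0 < derivWithin (fun s => (γ s).1) J s ∧
        metricSpeed (conformalMetric h V hV hpos) (fun s => (γ s).2) J s ≤
          derivWithin (fun s => (γ s).1) J s := by
  have hvelocity (hJ : J.OrdConnected) (hn : J.Nontrivial)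
      (hγ : ContMDiffOn 𝓘(ℝ, ℝ) (𝓘(ℝ, ℝ).prod 𝓘(ℝ, E)) ∞ γ J) (s : ℝ) (hs : s ∈ J) :=
    have hdiff := (hγ s hs).mdifferentiableWithinAt (by simp)
    have hunique := uniqueDiffOn_of_ordConnected hJ hn s hs
    isCausalVector_and_future_iff (h := h) hV hpos (mfderiv_fst_mfderivWithin hdiff hunique)
      (mfderiv_snd_mfderivWithin hdiff hunique)
  constructor
  · intro H
    exact ⟨H.ordConnected, H.nontrivial, (contMDiff_fst.comp_contMDiffOn H.smooth).contDiffOn,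
      contMDiff_snd.comp_contMDiffOn H.smooth, fun s hs =>
      (hvelocity H.ordConnected H.nontrivial H.smooth s hs).1 ⟨H.causal s hs, H.future s hs⟩⟩
  · rintro ⟨hJ, hn, hτ, hc, hle⟩
    have hγ : ContMDiffOn 𝓘(ℝ, ℝ) (𝓘(ℝ, ℝ).prod 𝓘(ℝ, E)) ∞ γ J := hτ.contMDiffOn.prodMk hc
    exact ⟨hJ, hn, hγ, fun s hs => ((hvelocity hJ hn hγ s hs).2 (hle s hs)).1,
      fun s hs => ((hvelocity hJ hn hγ s hs).2 (hle s hs)).2⟩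

lemma isFutureCausalCurve_of_metricSpeed_le_one {c : ℝ → S} {J : Set ℝ} (hJ : J.OrdConnected)
    (hn : J.Nontrivial) (hc : ContMDiffOn 𝓘(ℝ, ℝ) 𝓘(ℝ, E) ∞ c J)
    (hspeed : ∀ s ∈ J, metricSpeed (conformalMetric h V hV hpos) c J s ≤ 1) (t : ℝ) :
    IsFutureCausalCurve (𝓘(ℝ, ℝ).prod 𝓘(ℝ, E)) (staticMetric h V) timeVectorField
      (fun s => (t + s, c s)) J := by
  have hderiv : ∀ s ∈ J, derivWithin (fun s : ℝ => t + s) J s = 1 := fun s hs =>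
    ((hasDerivAt_id s).const_add t).hasDerivWithinAt.derivWithin
      (uniqueDiffOn_of_ordConnected hJ hn s hs)
  refine (isFutureCausalCurve_staticMetric_iff hV hpos).2 ⟨hJ, hn,
    (contDiff_const.add contDiff_id).contDiffOn, hc, fun s hs => ?_⟩
  rw [hderiv s hs]
  exact ⟨one_pos, hspeed s hs⟩

include hV hpos in
lemma IsFutureCausalCurve.timeReflection {γ : ℝ → ℝ × S} {J : Set ℝ}
    (hγ : IsFutureCausalCurve (𝓘(ℝ, ℝ).prod 𝓘(ℝ, E)) (staticMetric h V) timeVectorField γ J) :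
    IsFutureCausalCurve (𝓘(ℝ, ℝ).prod 𝓘(ℝ, E)) (staticMetric h V) timeVectorField
      (fun s => timeReflection (γ (-s))) (-J) := by
  rw [isFutureCausalCurve_staticMetric_iff hV hpos] at hγ ⊢
  obtain ⟨hJ, hn, hτ, hc, hle⟩ := hγ
  have hJneg : (-J).OrdConnected := hJ.preimage_anti fun _ _ => neg_le_neg
  have hnneg : (-J).Nontrivial := hn.preimage neg_surjective
  have hmaps : MapsTo (fun s : ℝ => -s) (-J) J := fun s hs => hs
  refine ⟨hJneg, hnneg, (hτ.comp contDiff_neg.contDiffOn hmaps).neg,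
    hc.comp contDiff_neg.contDiffOn.contMDiffOn hmaps, fun s hs => ?_⟩
  have hderiv : derivWithin (fun s => (_root_.timeReflection (γ (-s))).1) (-J) s =
      derivWithin (fun s => (γ s).1) J (-s) := by
    change derivWithin (fun s => -(γ (-s)).1) (-J) s = _
    rw [derivWithin.fun_neg, derivWithin_comp_neg (f := fun s => (γ s).1), neg_neg, neg_neg]
  rw [hderiv]
  have hspeed := metricSpeed_comp_neg (k := conformalMetric h V hV hpos)
    ((hc (-s) hs).mdifferentiableWithinAt (by simp)) (uniqueDiffOn_of_ordConnected hJneg hnneg s hs)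
  exact ⟨(hle (-s) hs).1, hspeed.le.trans (hle (-s) hs).2⟩

include hV hpos in
lemma IsFutureCausalCurve.monotoneOn_fst {γ : ℝ → ℝ × S} {J : Set ℝ}
    (hγ : IsFutureCausalCurve (𝓘(ℝ, ℝ).prod 𝓘(ℝ, E)) (staticMetric h V) timeVectorField γ J) :
    MonotoneOn (fun s => (γ s).1) J := by
  obtain ⟨hJ, -, hτ, -, hle⟩ := (isFutureCausalCurve_staticMetric_iff hV hpos).1 hγ
  refine monotoneOn_of_deriv_nonneg hJ.convex hτ.continuousOn
    ((hτ.differentiableOn (by simp)).mono interior_subset) fun s hs => ?_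
  rw [← derivWithin_of_mem_nhds (mem_interior_iff_mem_nhds.1 hs)]
  exact (hle s (interior_subset hs)).1.le

lemma IsFutureCausalCurve.metricEDist_snd_le {γ : ℝ → ℝ × S} {J : Set ℝ}
    (hγ : IsFutureCausalCurve (𝓘(ℝ, ℝ).prod 𝓘(ℝ, E)) (staticMetric h V) timeVectorField γ J)
    {s t : ℝ} (hs : s ∈ J) (ht : t ∈ J) :
    metricEDist (conformalMetric h V hV hpos) (γ s).2 (γ t).2 ≤ edist (γ s).1 (γ t).1 := by
  wlog hst : s ≤ t generalizing s t
  · rw [metricEDist_comm, edist_comm]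
    exact this ht hs (le_of_not_ge hst)
  rcases hst.eq_or_lt with rfl | hlt
  · simp [metricEDist_self]
  rw [edist_eq_ofReal_sub (hγ.monotoneOn_fst hV hpos hs ht hst)]
  obtain ⟨hJ, -, hτ, hc, hle⟩ := (isFutureCausalCurve_staticMetric_iff hV hpos).1 hγ
  have hsub : Icc s t ⊆ J := hJ.out hs ht
  refine metricEDist_le_of_metricSpeed_le_derivWithin (c := fun r => (γ r).2)
    (τ := fun r => (γ r).1) hlt ((hc.mono hsub).of_le (by simp)) ((hτ.mono hsub).of_le (by simp))
    fun r hr => ?_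
  have hunique := uniqueDiffOn_Icc hlt r hr
  rw [metricSpeed_subset hsub ((hc r (hsub hr)).mdifferentiableWithinAt (by simp)) hunique,
    derivWithin_subset hsub hunique (hτ.differentiableOn (by simp) r (hsub hr))]
  exact (hle r (hsub hr)).2

end StaticCausality

section CauchyDevelopment

lemma tendsto_neg_atTop_atBot_neg (J : Set ℝ) :
    Tendsto (fun s : J => (⟨-s, by simp⟩ : (-J : Set ℝ))) atTop atBot := by
  refine tendsto_atBot.2 fun b => ?_
  filter_upwards [eventually_ge_atTop (⟨-b, b.2⟩ : J)] with s hs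
  exact neg_le.1 (show -(b : ℝ) ≤ s from hs)

lemma tendsto_neg_atBot_atTop_neg (J : Set ℝ) :
    Tendsto (fun s : J => (⟨-s, by simp⟩ : (-J : Set ℝ))) atBot atTop := by
  refine tendsto_atTop.2 fun b => ?_
  filter_upwards [eventually_le_atBot (⟨-b, b.2⟩ : J)] with s hs
  exact le_neg.1 (show (s : ℝ) ≤ -(b : ℝ) from hs)

lemma cauchy_map_of_edist_le_edist {ι X Y : Type*} [PseudoEMetricSpace X] [PseudoEMetricSpace Y]
    {l : Filter ι} [l.NeBot] {f : ι → X} {g : ι → Y} (hg : Cauchy (map g l))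
    (hfg : ∀ i j, edist (f i) (f j) ≤ edist (g i) (g j)) : Cauchy (map f l) := by
  rw [cauchy_map_iff', uniformity_basis_edist.tendsto_right_iff] at hg ⊢
  exact fun ε hε => (hg ε hε).mono fun p hp => (hfg p.1 p.2).trans_lt hp

lemma timeReflection_involutive {S : Type*} :
    Function.Involutive (timeReflection : ℝ × S → ℝ × S) := fun x => by
  simp [timeReflection]

lemma timeReflection_mem_image {S : Type*} {γ : ℝ → ℝ × S} {J : Set ℝ} {x : ℝ × S}
    (hx : x ∈ γ '' J) : timeReflection x ∈ (fun s => timeReflection (γ (-s))) '' (-J) := by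
  obtain ⟨s, hs, rfl⟩ := hx
  exact ⟨-s, by simpa using hs, by simp⟩

lemma image_inter_zeroSlice_nonempty_of_timeReflection {S : Type*} {γ : ℝ → ℝ × S} {J : Set ℝ}
    (hγ : ((fun s => timeReflection (γ (-s))) '' (-J) ∩ zeroSlice S).Nonempty) :
    (γ '' J ∩ zeroSlice S).Nonempty := by
  obtain ⟨-, ⟨s, hs, rfl⟩, h0⟩ := hγ
  exact ⟨γ (-s), ⟨-s, hs, rfl⟩, neg_eq_zero.1 h0⟩

variable {S : Type*} [TopologicalSpace S] {γ : ℝ → ℝ × S} {J : Set ℝ}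

lemma continuous_timeReflection : Continuous (timeReflection : ℝ × S → ℝ × S) :=
  continuous_fst.neg.prodMk continuous_snd

lemma IsFutureInextendible.timeReflection (hγ : IsFutureInextendible γ J) :
    IsPastInextendible (fun s => timeReflection (γ (-s))) (-J) := by
  rintro ⟨q, hq⟩
  refine hγ ⟨_root_.timeReflection q, ((continuous_timeReflection.tendsto q).comp
    (hq.comp (tendsto_neg_atTop_atBot_neg J))).congr fun s => ?_⟩
  simp [_root_.timeReflection]

lemma IsPastInextendible.timeReflection (hγ : IsPastInextendible γ J) :
    IsFutureInextendible (fun s => timeReflection (γ (-s))) (-J) := by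
  rintro ⟨q, hq⟩
  refine hγ ⟨_root_.timeReflection q, ((continuous_timeReflection.tendsto q).comp
    (hq.comp (tendsto_neg_atBot_atTop_neg J))).congr fun s => ?_⟩
  simp [_root_.timeReflection]

lemma isFutureInextendible_of_tendsto_fst_atTop
    (hγ : Tendsto (fun s : J => (γ s).1) atTop atTop) (hJ : J.Nonempty) :
    IsFutureInextendible γ J := by
  have := hJ.to_subtype
  rintro ⟨q, hq⟩
  exact not_tendsto_nhds_of_tendsto_atTop hγ q.1 ((continuous_fst.tendsto q).comp hq)

lemma isFutureInextendible_Ico {a b : ℝ} (hab : a < b)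
    (hγ : ¬ ∃ q, Tendsto (fun s => (γ s).2) (𝓝[<] b) (𝓝 q)) : IsFutureInextendible γ (Ico a b) := by
  rintro ⟨q, hq⟩
  have hmap : map ((↑) : Ico a b → ℝ) atTop = 𝓝[<] b :=
    map_coe_atTop_of_Ioo_subset Ico_subset_Iio_self fun _ _ => ⟨a, hab, Ioo_subset_Ico_self⟩
  refine hγ ⟨q.2, ?_⟩
  rw [← hmap]
  exact tendsto_map'_iff.2 ((continuous_snd.tendsto q).comp hq)

variable {E : Type*} [NormedAddCommGroup E] [NormedSpace ℝ E]
  [ChartedSpace E S] [IsManifold 𝓘(ℝ, E) ∞ S]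
  {h : ContMDiffRiemannianMetric 𝓘(ℝ, E) ∞ E (fun p : S => TangentSpace 𝓘(ℝ, E) p)}
  {V : S → ℝ} (hV : ContMDiff 𝓘(ℝ, E) 𝓘(ℝ, ℝ) ∞ V) (hpos : ∀ p, 0 < V p)

include hV hpos in
lemma timeReflection_mem_pastCauchyDevelopment_iff {x : ℝ × S} :
    timeReflection x ∈ pastCauchyDevelopment (𝓘(ℝ, ℝ).prod 𝓘(ℝ, E)) (staticMetric h V)
        timeVectorField (zeroSlice S) ↔
      x ∈ futureCauchyDevelopment (𝓘(ℝ, ℝ).prod 𝓘(ℝ, E)) (staticMetric h V) timeVectorField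
        (zeroSlice S) := by
  constructor
  · intro hx γ J hγ hJ hxγ
    exact image_inter_zeroSlice_nonempty_of_timeReflection
      (hx _ _ (hγ.timeReflection hV hpos) hJ.timeReflection (timeReflection_mem_image hxγ))
  · intro hx γ J hγ hJ hxγ
    refine image_inter_zeroSlice_nonempty_of_timeReflection
      (hx _ _ (hγ.timeReflection hV hpos) hJ.timeReflection ?_)
    simpa only [timeReflection_involutive x] using timeReflection_mem_image hxγ

include hV hpos in
lemma pastCauchyDevelopment_zeroSlice_eq_image :
    pastCauchyDevelopment (𝓘(ℝ, ℝ).prod 𝓘(ℝ, E)) (staticMetric h V) timeVectorField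
        (zeroSlice S) =
      timeReflection '' futureCauchyDevelopment (𝓘(ℝ, ℝ).prod 𝓘(ℝ, E)) (staticMetric h V)
        timeVectorField (zeroSlice S) := by
  ext x
  rw [timeReflection_involutive.image_eq_preimage_symm, mem_preimage,
    ← timeReflection_mem_pastCauchyDevelopment_iff hV hpos, timeReflection_involutive]

include hV hpos in
lemma nonpos_of_mem_pastCauchyDevelopment_zeroSlice {x : ℝ × S}
    (hx : x ∈ pastCauchyDevelopment (𝓘(ℝ, ℝ).prod 𝓘(ℝ, E)) (staticMetric h V) timeVectorField
      (zeroSlice S)) : x.1 ≤ 0 := by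
  by_contra! ht
  have hcausal : IsFutureCausalCurve (𝓘(ℝ, ℝ).prod 𝓘(ℝ, E)) (staticMetric h V) timeVectorField
      (fun s => (x.1 + s, x.2)) (Ici 0) :=
    isFutureCausalCurve_of_metricSpeed_le_one hV hpos ordConnected_Ici
      ⟨0, self_mem_Ici, 1, mem_Ici.2 zero_le_one, zero_ne_one⟩ contMDiffOn_const
      (fun s _ => (metricSpeed_const x.2 _ s).trans_le zero_le_one) x.1
  have hinextendible : IsFutureInextendible (fun s => (x.1 + s, x.2)) (Ici (0 : ℝ)) :=
    isFutureInextendible_of_tendsto_fst_atTop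
      (tendsto_atTop_add_const_left _ _ (tendsto_comp_val_Ici_atTop.2 tendsto_id)) nonempty_Ici
  obtain ⟨-, ⟨s, hs, rfl⟩, h0⟩ := hx _ _ hcausal hinextendible ⟨0, self_mem_Ici, by simp⟩
  exact (add_pos_of_pos_of_nonneg ht hs).ne' h0

variable [FiniteDimensional ℝ E] [T2Space S]

lemma metricClosedBall_eq_closedEBall
    (k : ContMDiffRiemannianMetric 𝓘(ℝ, E) ∞ E (fun p : S => TangentSpace 𝓘(ℝ, E) p))
    (p : S) (r : ℝ) :
    letI := metricEMetricSpace k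
    metricClosedBall k p r = Metric.closedEBall p (ENNReal.ofReal r) := by
  let := metricEMetricSpace k
  ext q
  rw [Metric.mem_closedEBall, edist_comm]
  rfl

lemma isCompact_metricClosedBall_of_mem_pastCauchyDevelopment {x : ℝ × S}
    (hx : x ∈ pastCauchyDevelopment (𝓘(ℝ, ℝ).prod 𝓘(ℝ, E)) (staticMetric h V) timeVectorField
      (zeroSlice S)) :
    IsCompact (metricClosedBall (conformalMetric h V hV hpos) x.2 (-x.1)) := by
  set k := conformalMetric h V hV hpos
  let := metricEMetricSpace k
  have : LocallyCompactSpace S := Manifold.locallyCompact_of_finiteDimensional 𝓘(ℝ, E)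
  have hX := hasApproxIntermediatePoints_metricEMetricSpace k
  rw [metricClosedBall_eq_closedEBall]
  by_contra hnc
  obtain ⟨R, hR, hRx, hlt, hRnc⟩ := hX.exists_first_noncompact_radius hnc
  obtain ⟨c, hc0, hray, hclim⟩ := hX.exists_ray hR hlt hRnc
  obtain ⟨hsmooth, hspeed⟩ := contMDiffOn_of_metricEDist_eq (k := k) hray
  have hcausal := isFutureCausalCurve_of_metricSpeed_le_one hV hpos ordConnected_Ico
    ⟨0, ⟨le_rfl, hR⟩, R / 2, ⟨(half_pos hR).le, half_lt_self hR⟩, (half_pos hR).ne⟩ hsmooth hspeed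
    x.1
  obtain ⟨-, ⟨s, hs, rfl⟩, h0⟩ := hx _ _ hcausal (isFutureInextendible_Ico hR hclim)
    ⟨0, ⟨le_rfl, hR⟩, by simp [hc0]⟩
  have hzero : x.1 + s = 0 := h0
  linarith [hs.2]

lemma IsFutureCausalCurve.exists_tendsto_atTop
    (hγ : IsFutureCausalCurve (𝓘(ℝ, ℝ).prod 𝓘(ℝ, E)) (staticMetric h V) timeVectorField γ J)
    {T : ℝ} (hT : ∀ s ∈ J, (γ s).1 ≤ T) {s₀ : ℝ} (hs₀ : s₀ ∈ J)
    (hc : IsCompact (metricClosedBall (conformalMetric h V hV hpos) (γ s₀).2 (T - (γ s₀).1))) :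
    ∃ q, Tendsto (fun s : J => γ s) atTop (𝓝 q) := by
  let := metricEMetricSpace (conformalMetric h V hV hpos)
  have hmono := hγ.monotoneOn_fst hV hpos
  have hJ : Nonempty J := ⟨⟨s₀, hs₀⟩⟩
  have htime : Tendsto (fun s : J => (γ s).1) atTop (𝓝 (⨆ s : J, (γ s).1)) :=
    tendsto_atTop_ciSup (fun s t hst => hmono s.2 t.2 hst)
      ⟨T, forall_mem_range.2 fun s => hT s s.2⟩
  have hball : ∀ᶠ s : J in atTop,
      (γ s).2 ∈ metricClosedBall (conformalMetric h V hV hpos) (γ s₀).2 (T - (γ s₀).1) := by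
    filter_upwards [eventually_ge_atTop (⟨s₀, hs₀⟩ : J)] with s hs
    refine (hγ.metricEDist_snd_le hV hpos hs₀ s.2).trans ?_
    rw [edist_eq_ofReal_sub (hmono hs₀ s.2 hs)]
    exact ENNReal.ofReal_le_ofReal (sub_le_sub_right (hT s s.2) _)
  have hcauchy : Cauchy (map (fun s : J => (γ s).2) atTop) :=
    cauchy_map_of_edist_le_edist htime.cauchy_map fun s t =>
      hγ.metricEDist_snd_le hV hpos s.2 t.2
  obtain ⟨q, -, hq⟩ := hc.isComplete _ hcauchy (le_principal_iff.2 hball)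
  exact ⟨(⨆ s : J, (γ s).1, q), htime.prodMk_nhds hq⟩

lemma mem_pastCauchyDevelopment_of_isCompact_metricClosedBall {x : ℝ × S} (hx : x.1 ≤ 0)
    (hc : IsCompact (metricClosedBall (conformalMetric h V hV hpos) x.2 (-x.1))) :
    x ∈ pastCauchyDevelopment (𝓘(ℝ, ℝ).prod 𝓘(ℝ, E)) (staticMetric h V) timeVectorField
      (zeroSlice S) := by
  rintro γ J hγ hinextendible ⟨s₀, hs₀, rfl⟩
  by_contra hmiss
  refine hinextendible (hγ.exists_tendsto_atTop hV hpos (T := 0) (fun s hs => ?_) hs₀ (by simpa))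
  by_contra! hs_pos
  obtain ⟨r, hr, hr0⟩ := hγ.ordConnected.isPreconnected.intermediate_value hs₀ hs
    (continuous_fst.comp_continuousOn hγ.smooth.continuousOn) ⟨hx, hs_pos.le⟩
  exact hmiss ⟨γ r, mem_image_of_mem γ hr, hr0⟩

theorem pastCauchyDevelopment_zeroSlice :
    pastCauchyDevelopment (𝓘(ℝ, ℝ).prod 𝓘(ℝ, E)) (staticMetric h V) timeVectorField
        (zeroSlice S) =
      {x : ℝ × S | x.1 ≤ 0 ∧
        IsCompact (metricClosedBall (conformalMetric h V hV hpos) x.2 (-x.1))} :=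
  Set.ext fun _ => ⟨fun hx => ⟨nonpos_of_mem_pastCauchyDevelopment_zeroSlice hV hpos hx,
      isCompact_metricClosedBall_of_mem_pastCauchyDevelopment hV hpos hx⟩,
    fun hx => mem_pastCauchyDevelopment_of_isCompact_metricClosedBall hV hpos hx.1 hx.2⟩

theorem futureCauchyDevelopment_zeroSlice :
    futureCauchyDevelopment (𝓘(ℝ, ℝ).prod 𝓘(ℝ, E)) (staticMetric h V) timeVectorField
        (zeroSlice S) =
      {x : ℝ × S | 0 ≤ x.1 ∧
        IsCompact (metricClosedBall (conformalMetric h V hV hpos) x.2 x.1)} := by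
  ext x
  rw [← timeReflection_mem_pastCauchyDevelopment_iff hV hpos,
    pastCauchyDevelopment_zeroSlice hV hpos]
  simp [timeReflection]

theorem cauchyDevelopment_zeroSlice :
    cauchyDevelopment (𝓘(ℝ, ℝ).prod 𝓘(ℝ, E)) (staticMetric h V) timeVectorField (zeroSlice S) =
      {x : ℝ × S | IsCompact (metricClosedBall (conformalMetric h V hV hpos) x.2 |x.1|)} := by
  ext x
  rw [cauchyDevelopment, futureCauchyDevelopment_zeroSlice hV hpos,
    pastCauchyDevelopment_zeroSlice hV hpos]
  constructor
  · rintro (⟨hx, hc⟩ | ⟨hx, hc⟩)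
    · rwa [mem_ofPred_eq, abs_of_nonneg hx]
    · rwa [mem_ofPred_eq, abs_of_nonpos hx]
  · intro hc
    rw [mem_ofPred_eq] at hc
    rcases le_total 0 x.1 with hx | hx
    · rw [abs_of_nonneg hx] at hc
      exact Or.inl ⟨hx, hc⟩
    · rw [abs_of_nonpos hx] at hc
      exact Or.inr ⟨hx, hc⟩

theorem isOpen_setOf_isCompact_metricClosedBall
    (k : ContMDiffRiemannianMetric 𝓘(ℝ, E) ∞ E (fun p : S => TangentSpace 𝓘(ℝ, E) p)) :
    IsOpen {x : ℝ × S | IsCompact (metricClosedBall k x.2 |x.1|)} := by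
  let := metricEMetricSpace k
  have : LocallyCompactSpace S := Manifold.locallyCompact_of_finiteDimensional 𝓘(ℝ, E)
  simp only [metricClosedBall_eq_closedEBall]
  exact (hasApproxIntermediatePoints_metricEMetricSpace k).isOpen_setOf_isCompact_closedEBall

end CauchyDevelopment

theorem mainTheorem8
    {E : Type*} [NormedAddCommGroup E] [NormedSpace ℝ E] [FiniteDimensional ℝ E]
    {S : Type*} [TopologicalSpace S] [T2Space S] [ChartedSpace E S] [IsManifold 𝓘(ℝ, E) ∞ S]
    (h : ContMDiffRiemannianMetric 𝓘(ℝ, E) ∞ E (fun p : S => TangentSpace 𝓘(ℝ, E) p))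
    (V : S → ℝ) (hV : ContMDiff 𝓘(ℝ, E) 𝓘(ℝ, ℝ) ∞ V) (hpos : ∀ p, 0 < V p) :
    -- the future Cauchy development
    (futureCauchyDevelopment (𝓘(ℝ, ℝ).prod 𝓘(ℝ, E)) (staticMetric h V) timeVectorField
        (zeroSlice S) =
      {x : ℝ × S | 0 ≤ x.1 ∧ IsCompact (metricClosedBall (conformalMetric h V hV hpos) x.2 x.1)}) ∧
    -- the past Cauchy development
    (pastCauchyDevelopment (𝓘(ℝ, ℝ).prod 𝓘(ℝ, E)) (staticMetric h V) timeVectorField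
        (zeroSlice S) =
      {x : ℝ × S | ∃ (t : ℝ) (p : S), x = (-t, p) ∧ 0 ≤ t ∧
        IsCompact (metricClosedBall (conformalMetric h V hV hpos) p t)} ∧
    pastCauchyDevelopment (𝓘(ℝ, ℝ).prod 𝓘(ℝ, E)) (staticMetric h V) timeVectorField
        (zeroSlice S) =
      timeReflection '' futureCauchyDevelopment (𝓘(ℝ, ℝ).prod 𝓘(ℝ, E)) (staticMetric h V) timeVectorField
        (zeroSlice S)) ∧
    -- the Cauchy development
    (cauchyDevelopment (𝓘(ℝ, ℝ).prod 𝓘(ℝ, E)) (staticMetric h V) timeVectorField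
        (zeroSlice S) =
      futureCauchyDevelopment (𝓘(ℝ, ℝ).prod 𝓘(ℝ, E)) (staticMetric h V) timeVectorField
        (zeroSlice S) ∪
      pastCauchyDevelopment (𝓘(ℝ, ℝ).prod 𝓘(ℝ, E)) (staticMetric h V) timeVectorField
        (zeroSlice S) ∧
    cauchyDevelopment (𝓘(ℝ, ℝ).prod 𝓘(ℝ, E)) (staticMetric h V) timeVectorField
        (zeroSlice S) =
      {x : ℝ × S | IsCompact (metricClosedBall (conformalMetric h V hV hpos) x.2 |x.1|)}) ∧
    -- openness
    IsOpen (cauchyDevelopment (𝓘(ℝ, ℝ).prod 𝓘(ℝ, E)) (staticMetric h V) timeVectorField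
        (zeroSlice S)) := by
  refine ⟨futureCauchyDevelopment_zeroSlice hV hpos, ⟨?_,
    pastCauchyDevelopment_zeroSlice_eq_image hV hpos⟩,
    ⟨rfl, cauchyDevelopment_zeroSlice hV hpos⟩, ?_⟩
  · rw [pastCauchyDevelopment_zeroSlice hV hpos]
    ext x
    constructor
    · rintro ⟨ht, hc⟩
      exact ⟨-x.1, x.2, by simp, neg_nonneg.2 ht, hc⟩
    · rintro ⟨t, p, rfl, ht, hc⟩
      exact ⟨neg_nonpos.2 ht, by simpa only [neg_neg] using hc⟩
  · rw [cauchyDevelopment_zeroSlice hV hpos]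
    exact isOpen_setOf_isCompact_metricClosedBall _
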